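/- Let $p>1$ and $m\ge 0$ be integers. A position of Welter's game $\mathcal W^m$ is an $m$-tuple $X=(x^1,\dots,x^m)$ of pairwise distinct non-negative integers. For a positive integer $k$, let $\mathcal W^m_{p,k}$ be the game with these positions in which one can move from $X=(x^1,\dots,x^m)$ to $Y=(y^1,\dots,y^m)$ if and only if - $0<|\{i : x^i\ne y^i\}|<k$, - $y^i\le x^i$ for $1\le i\le m$, and - $\operatorname{ord}_p\bigl(\sum_{i}(x^i-y^i)\bigr)=\min\{\operatorname{ord}_p(x^i-y^i):1\le i\le m\}$, where $\operatorname{ord}_p(x)=\max\{L\ge 0: p^L\mid x\}$ for $x\neq 0$ and $\operatorname{ord}_p(0)=\infty$. The Sprague-Grundy number $\mathrm{sg}(X)$ is the least non-negative integer that is not the Sprague-Grundy number of a position to which one can move from $X$. The game $\mathcal W^m_{p,k}$ is called a $p$-saturation of $\mathcal W^m$ if it has the same Sprague-Grundy function as $\mathcal W^m_{p,m+1}$. A descendant of $X$ is a position that can be reached from $X$ by finitely many (possibly zero) moves. If $x^{\sigma(1)}>\dots>x^{\sigma(m)}$ are the coordinates of $X$ in decreasing order, let $\lambda(X)$ be the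 Young diagram $\{(i,j): 1\le i\le m,\ 1\le j\le x^{\sigma(i)}-m+i\}$. For $(i,j)\in\lambda(X)$, the hook $H_{i,j}(X)$ is the set of all $(i',j')\in\lambda(X)$ with ($i'\ge i$ and $j'=j$) or ($i'=i$ and $j'\ge j$); it is called a $p^L$-hook if $p^L$ divides $|H_{i,j}(X)|$. For $x\in\mathbb Z$ and $L\ge 0$, the $L$-th $p$-adic digit of $x$ is $\lfloor x/p^L\rfloor \bmod p$. Identify $x$ with its sequence of digits in $(\mathbb Z/p)^{\mathbb N}$, let $\oplus_p$ and $\ominus_p$ be termwise addition and subtraction of such sequences, and let $\mathfrak N_p(x)=x\ominus_p(x-1)$. **Theorem.** Let $X=(x^1,\dots,x^m)$ be a position in a $p$-saturation of $\mathcal W^m$, and let $\mathrm{sg}$ be the Sprague-Grundy function of this game. Then $$\mathrm{sg}(X)=\sum_{L\ge 0} h_L\,p^L,$$ where $h_L\in\{0,\dots,p-1\}$ is the remainder modulo $p$ of the number of $p^L$-hooks in $\lambda(X)$. Moreover, $$\mathrm{sg}(X)=x^1\oplus_p\cdots\oplus_p x^m\ominus_p\Bigl(\bigoplus_{i<j}\mathfrak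 N_p(x^i-x^j)\Bigr)=\bigoplus_{(i,j)\in\lambda(X)}\mathfrak N_p\bigl(|H_{i,j}(X)|\bigr),$$ where $\bigoplus$ denotes iterated $\oplus_p$. Further, $X$ has a descendant $Y$ with $\lambda(Y)\subseteq\lambda(X)$ and $|\lambda(Y)|=\mathrm{sg}(Y)=\mathrm{sg}(X)$. -/

import Mathlib

namespace WelterGame

/-! ### Impartial games -/

/-- An impartial game with set of positions `V`: a directed graph on `V` such that, for every
vertex `X`, the lengths of the paths starting at `X` are bounded (so that the maximum length of a
path from `X` is finite). A path of length `n` is given by its vertices `c 0, …, c n`. -/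
structure ImpartialGame (V : Type*) where
  /-- `Move X Y` says that there is an edge from `X` to `Y`, that is, `Y` is an option of `X`. -/
  Move : V → V → Prop
  bounded : ∀ X : V, ∃ N : ℕ, ∀ (n : ℕ) (c : ℕ → V),
    c 0 = X → (∀ i < n, Move (c i) (c (i + 1))) → n ≤ N

namespace ImpartialGame

variable {V : Type*} (G : ImpartialGame V)

theorem wellFounded : WellFounded (fun Y X : V => G.Move X Y) := by
  rw [wellFounded_iff_isEmpty_descending_chain]
  refine ⟨fun ⟨c, hc⟩ => ?_⟩
  obtain ⟨N, hN⟩ := G.bounded (c 0)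
  have h := hN (N + 1) c rfl (fun i _ => hc i)
  omega

/-- The Sprague-Grundy function: `sg X` is the least natural number that is not the
Sprague-Grundy number of an option of `X` (see `sg_eq`). -/
noncomputable def sg : V → ℕ :=
  G.wellFounded.fix fun X ih => sInf {n : ℕ | ∀ (Y : V) (h : G.Move X Y), ih Y h ≠ n}

theorem sg_eq (X : V) : G.sg X = sInf {n : ℕ | ∀ Y : V, G.Move X Y → G.sg Y ≠ n} :=
  G.wellFounded.fix_eq _ X

/-- `Y` is a descendant of `X` if there is a path (possibly of length `0`) from `X` to `Y`. -/
def IsDescendant (X Y : V) : Prop := Relation.ReflTransGen G.Move X Y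

end ImpartialGame

/-! ### Welter's game with `p`-index `k`, and `p`-saturations -/

/-- A position of Welter's game with `m` coins: the coins `1, …, m` are on the pairwise
different squares `x 1, …, x m`. -/
abbrev Position (m : ℕ) : Type := Fin m ↪ ℕ

/-- The moves of Welter's game with `m` coins and `p`-index `k`. The `p`-adic order is
`emultiplicity (p : ℤ)`, which is `⊤` at `0`. -/
def WelterMove (p m k : ℕ) (x y : Position m) : Prop :=
  (0 < hammingDist (⇑x) (⇑y) ∧ hammingDist (⇑x) (⇑y) < k) ∧
  (∀ i, y i ≤ x i) ∧
  emultiplicity (p : ℤ) (∑ i, ((x i : ℤ) - (y i : ℤ))) =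
    ⨅ i, emultiplicity (p : ℤ) ((x i : ℤ) - (y i : ℤ))

theorem WelterMove.sum_lt {p m k : ℕ} {x y : Position m} (h : WelterMove p m k x y) :
    ∑ i, y i < ∑ i, x i := by
  obtain ⟨⟨h0, -⟩, hle, -⟩ := h
  have hne : (⇑x) ≠ (⇑y) := hammingDist_pos.1 h0
  obtain ⟨i, hi⟩ := Function.ne_iff.1 hne
  exact Finset.sum_lt_sum (fun i _ => hle i)
    ⟨i, Finset.mem_univ i, lt_of_le_of_ne (hle i) (Ne.symm hi)⟩

/-- Welter's game with `m` coins and `p`-index `k`. -/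
def welter (p m k : ℕ) : ImpartialGame (Position m) where
  Move := WelterMove p m k
  bounded X := by
    refine ⟨∑ i, X i, fun n c h0 hc => ?_⟩
    have key : ∀ j ≤ n, (∑ i, c j i) + j ≤ ∑ i, X i := by
      intro j
      induction j with
      | zero => intro _; simp [h0]
      | succ j ih =>
        intro hj
        have h1 := ih (by omega)
        have h2 := (hc j (by omega)).sum_lt
        omega
    have := key n le_rfl
    omega

/-- Welter's game with `m` coins and `p`-index `k` is a `p`-saturation of Welter's game with `m`
coins if it has the same Sprague-Grundy function as the one with `p`-index `m + 1`. -/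
def IsSaturation (p m k : ℕ) : Prop :=
  0 < k ∧ (welter p m k).sg = (welter p m (m + 1)).sg

/-! ### The Young diagram of a position, and its hooks -/

/-- The coordinates of a position in decreasing order. -/
def sorted {m : ℕ} (x : Position m) (i : Fin m) : ℕ := x (Tuple.sort (⇑x) i.rev)

theorem sorted_strictAnti {m : ℕ} (x : Position m) : StrictAnti (sorted x) := by
  have hm : StrictMono (⇑x ∘ Tuple.sort (⇑x)) :=
    (Tuple.monotone_sort (⇑x)).strictMono_of_injective
      (x.injective.comp (Tuple.sort (⇑x)).injective)
  intro i j hij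
  exact hm (Fin.rev_lt_rev.2 hij)

theorem sorted_add_le {m : ℕ} (x : Position m) {i j : Fin m} (hij : i ≤ j) :
    sorted x j + (j - i : ℕ) ≤ sorted x i := by
  obtain ⟨i, hi⟩ := i
  obtain ⟨j, hj⟩ := j
  have hij' : i ≤ j := hij
  induction j, hij' using Nat.le_induction with
  | base => simp
  | succ j hle ih =>
    have h1 := ih (by omega) hle
    have h2 : sorted x ⟨j + 1, hj⟩ < sorted x ⟨j, by omega⟩ :=
      sorted_strictAnti x (Fin.mk_lt_mk.2 (Nat.lt_succ_self j))
    simp only at h1 ⊢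
    omega

/-- The Young diagram `λ(x)` of the partition `(x₁ - m + 1, x₂ - m + 2, …, xₘ)`, where
`x₁ > x₂ > ⋯ > xₘ` are the coordinates of `x` in decreasing order. Rows and columns are numbered
from `0`, as everywhere in `YoungDiagram`; so row `i` has `x_{i+1} - (m - 1 - i)` cells. -/
def diagram {m : ℕ} (x : Position m) : YoungDiagram where
  cells := (Finset.univ : Finset (Fin m)).biUnion fun i =>
    (Finset.range (sorted x i - (m - 1 - i))).image fun j => ((i : ℕ), j)
  isLowerSet := by
    rintro ⟨a, b⟩ ⟨a', b'⟩ hle h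
    obtain ⟨ha, hb⟩ : a' ≤ a ∧ b' ≤ b := hle
    simp only [Finset.coe_biUnion, Finset.coe_image, Set.mem_iUnion, Set.mem_image,
      Finset.mem_coe, Finset.mem_univ, Finset.mem_range, Prod.mk.injEq] at h ⊢
    obtain ⟨i, -, j, hj, rfl, rfl⟩ := h
    have hi := i.isLt
    have h1 := sorted_add_le x (i := ⟨a', by omega⟩) (j := i) ha
    refine ⟨⟨a', by omega⟩, trivial, b', ?_, rfl, rfl⟩
    simp only at h1 ⊢
    omega

/-- The hook `H_{i,j}` of the cell `c = (i, j)` of a Young diagram. -/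
def hook (μ : YoungDiagram) (c : ℕ × ℕ) : Finset (ℕ × ℕ) :=
  μ.cells.filter fun d => (c.1 ≤ d.1 ∧ d.2 = c.2) ∨ (d.1 = c.1 ∧ c.2 ≤ d.2)

/-- The number of `p ^ L`-hooks of `μ`, that is, of hooks whose size is a multiple of `p ^ L`. -/
def hookCount (p : ℕ) (μ : YoungDiagram) (L : ℕ) : ℕ :=
  (μ.cells.filter fun c => p ^ L ∣ (hook μ c).card).card

/-- The number whose `L`-th `p`-ary digit is the number of `p ^ L`-hooks of `μ` modulo `p`
(the sum has only finitely many nonzero terms when `1 < p`, see `finite_support_hookNumber`). -/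
noncomputable def hookNumber (p : ℕ) (μ : YoungDiagram) : ℕ :=
  ∑ᶠ L : ℕ, (hookCount p μ L % p) * p ^ L

theorem finite_support_hookNumber {p : ℕ} (hp : 1 < p) (μ : YoungDiagram) :
    (Function.support fun L : ℕ => (hookCount p μ L % p) * p ^ L).Finite := by
  refine (Set.finite_lt_nat μ.card).subset fun L hL => ?_
  by_contra hlt
  have hlt' : μ.card ≤ L := not_lt.1 hlt
  apply hL
  have h0 : hookCount p μ L = 0 := by
    rw [hookCount, Finset.card_eq_zero, Finset.filter_eq_empty_iff]
    intro c hc hdvd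
    have hpos : 0 < (hook μ c).card :=
      Finset.card_pos.2 ⟨c, Finset.mem_filter.2 ⟨hc, Or.inl ⟨le_rfl, rfl⟩⟩⟩
    have h1 : p ^ L ≤ (hook μ c).card := Nat.le_of_dvd hpos hdvd
    have h2 : (hook μ c).card ≤ μ.card := Finset.card_le_card (Finset.filter_subset _ _)
    have h3 : L < p ^ L := Nat.lt_pow_self hp
    omega
  simp [h0]

/-! ### Addition and subtraction without carry -/

/-- The sequence of the digits of the `p`-adic expansion of an integer, as elements of `ℤ/p`: the
`L`-th digit of `x` is `⌊x / p ^ L⌋` modulo `p`. Integers are identified with their digit sequences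
(see `digits_injective`); on sequences in `ℕ → ZMod p`, addition and subtraction without carry are
the termwise operations `+` and `-`. -/
def digits (p : ℕ) (x : ℤ) : ℕ → ZMod p := fun L => ((x / (p : ℤ) ^ L : ℤ) : ZMod p)

theorem digits_injective {p : ℕ} (hp : 1 < p) : Function.Injective (digits p) := by
  intro x y h
  have key : ∀ L : ℕ, x % (p : ℤ) ^ L = y % (p : ℤ) ^ L := by
    intro L
    induction L with
    | zero => simp
    | succ L ih =>
      have h1 : x / (p : ℤ) ^ L ≡ y / (p : ℤ) ^ L [ZMOD p] :=
        (ZMod.intCast_eq_intCast_iff _ _ _).1 (congrFun h L)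
      have h2 : (p : ℤ) ^ L * (x / (p : ℤ) ^ L) ≡ (p : ℤ) ^ L * (y / (p : ℤ) ^ L)
          [ZMOD (p : ℤ) ^ L * p] := h1.mul_left'
      have h3 := h2.add_right (x % (p : ℤ) ^ L)
      rw [Int.mul_ediv_add_emod, ih, Int.mul_ediv_add_emod, ← pow_succ] at h3
      exact h3
  have hdvd : ∀ L : ℕ, (p : ℤ) ^ L ∣ y - x := fun L => Int.ModEq.dvd (key L)
  by_contra hne
  have hlt : (y - x).natAbs < p ^ (y - x).natAbs := Nat.lt_pow_self hp
  have hle : p ^ (y - x).natAbs ≤ (y - x).natAbs := by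
    refine Nat.le_of_dvd (Int.natAbs_pos.2 (sub_ne_zero.2 (Ne.symm hne))) ?_
    have h4 := Int.natAbs_dvd_natAbs.2 (hdvd (y - x).natAbs)
    rwa [Int.natAbs_pow, Int.natAbs_natCast] at h4
  omega

/-- `N_p(x) = x ⊖ (x - 1)`, the subtraction without carry of `x - 1` from `x`. -/
def carryfreeN (p : ℕ) (x : ℤ) : ℕ → ZMod p := digits p x - digits p (x - 1)

end WelterGame

/-! Write w_d for `weight x d`. In the row of the coin x_i of the sorted position, the hook lengths
are 1, …, x_i without the differences from x_i to the smaller coins. Hence w_d, the sum of the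
⌊x_i/d⌋ minus the number of pairs congruent modulo d, counts the hooks of length divisible by d
(`sum_hook_dvd`). Since the L-th digit of 𝔑_p(x) is 1 or 0 according as p^L divides x or not, both
digit formulas follow once `hookNumber`, with digits w_{p^L} mod p, is known to be the
Sprague-Grundy function (`sg_welter`).

No option has the same value: if a move has order N, all coins move by multiples of p^N, congruences
modulo p^N persist, and p^N times the drop of w_{p^N} is the total displacement. Its order is
exactly N, so digit N changes.

Every smaller n is reached: let N be the first digit where n differs from the value of x. It
suffices to find y below x, congruent to x modulo p^N, with w_{p^(N+l)} = ⌊n/p^(N+l)⌋ for all l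
(`exists_weight_eq_div`). The core weights c_d = w_d - p w_{dp} are nonnegative; if all of them from
p^N on are less than p, they are the base-p digits of w_{p^N}, which then determines the higher
weights. `exists_reduced` makes them less than p while keeping w_{p^N} large enough, and
`exists_weight_sub_one` then lowers w_{p^N} in unit steps, as a subtraction with borrow.

Both rest on `surplus`. Lowering one coin by q changes w_d by its surplus minus 1 if d does not
divide q. The surplus of a class is the sum over its subclasses, so a positive surplus can be
followed into ever finer classes down to a single coin, which can then be lowered by q. -/

namespace WelterGame

/-! ### Residue classes of coins, surpluses and movable sets. -/

section Residues

variable {m : ℕ}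

/-- The number of coins in `Z` whose square is congruent to `t` modulo `d`. -/
def residueCount (x : Position m) (Z : Finset (Fin m)) (d : ℕ) (t : ℤ) : ℤ :=
  ∑ i ∈ Z, if (d : ℤ) ∣ (x i : ℤ) - t then 1 else 0

/-- The number of coins congruent to `t` modulo `d`, normalized by `⌊t / d⌋`. -/
def charge (x : Position m) (d : ℕ) (t : ℤ) : ℤ :=
  residueCount x Finset.univ d t - t / d

/-- The difference of the charges of `t` and `t - q`. -/
def surplus (x : Position m) (q d : ℕ) (t : ℤ) : ℤ :=
  charge x d t - charge x d (t - q)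

/-- The total size of the `d`-quotient of the Young diagram of `x`. -/
def weight (x : Position m) (d : ℕ) : ℤ :=
  ∑ i, (x i : ℤ) / d -
    ∑ i, ∑ j ∈ Finset.univ.filter (fun j => i < j),
      if (d : ℤ) ∣ (x i : ℤ) - (x j : ℤ) then 1 else 0

theorem two_mul_sum_pairs {f : Fin m → Fin m → ℤ} (hsymm : ∀ i j, f i j = f j i) :
    2 * ∑ i, ∑ j ∈ Finset.univ.filter (fun j => i < j), f i j + ∑ i, f i i =
      ∑ i, ∑ j, f i j := by
  have h1 : ∀ i, ∑ j, f i j = ∑ j ∈ Finset.univ.filter (fun j => i < j), f i j +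
      ∑ j ∈ Finset.univ.filter (fun j => j < i), f i j + f i i := by
    intro i
    simp only [Finset.sum_filter]
    rw [← Finset.sum_add_distrib]
    have : f i i = ∑ j, if j = i then f i j else 0 := by simp
    rw [this, ← Finset.sum_add_distrib]
    refine Finset.sum_congr rfl fun j _ => ?_
    rcases lt_trichotomy i j with h | h | h
    · simp [h, h.not_gt, h.ne']
    · simp [h]
    · simp [h, h.not_gt, h.ne]
  have h2 : ∑ i, ∑ j ∈ Finset.univ.filter (fun j => j < i), f i j =
      ∑ i, ∑ j ∈ Finset.univ.filter (fun j => i < j), f i j := by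
    simp only [Finset.sum_filter]
    rw [Finset.sum_comm]
    exact Finset.sum_congr rfl fun i _ => Finset.sum_congr rfl fun j _ => by rw [hsymm]
  simp only [h1, Finset.sum_add_distrib, h2]
  ring

/-- Passing to ordered pairs makes the count symmetric in the coins; the summand `m` compensates for
the diagonal. -/
theorem two_mul_weight (x : Position m) (d : ℕ) :
    2 * weight x d = 2 * ∑ i, (x i : ℤ) / d + m -
      ∑ i, residueCount x Finset.univ d (x i) := by
  have := two_mul_sum_pairs (m := m)
    (f := fun i j => if (d : ℤ) ∣ (x i : ℤ) - (x j : ℤ) then 1 else 0)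
    (fun i j => by simp only [dvd_sub_comm])
  simp only [sub_self, dvd_zero, if_true, Finset.sum_const, Finset.card_univ, Fintype.card_fin,
    nsmul_eq_mul, mul_one] at this
  have h2 : ∑ i, residueCount x Finset.univ d (x i) =
      ∑ i, ∑ j, if (d : ℤ) ∣ (x i : ℤ) - (x j : ℤ) then (1 : ℤ) else 0 := by
    simp only [residueCount]
    rw [Finset.sum_comm]
  rw [h2, weight]
  linarith

theorem residueCount_nonneg (x : Position m) (Z : Finset (Fin m)) (d : ℕ) (t : ℤ) :
    0 ≤ residueCount x Z d t :=
  Finset.sum_nonneg fun i _ => by split_ifs <;> simp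

theorem residueCount_congr (x : Position m) (Z : Finset (Fin m)) {d : ℕ} {s t : ℤ}
    (h : (d : ℤ) ∣ s - t) : residueCount x Z d s = residueCount x Z d t := by
  refine Finset.sum_congr rfl fun i _ => ?_
  have : (d : ℤ) ∣ (x i : ℤ) - s ↔ (d : ℤ) ∣ (x i : ℤ) - t := by
    rw [show (x i : ℤ) - t = (x i - s) + (s - t) by ring]
    exact (dvd_add_left h).symm
  simp only [this]

theorem sum_dvd_sub_mul {d p : ℕ} (hd : 0 < d) (hp : 0 < p) (a : ℤ) :
    (∑ j ∈ Finset.range p, if ((d * p : ℕ) : ℤ) ∣ a - j * d then (1 : ℤ) else 0) =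
      if (d : ℤ) ∣ a then 1 else 0 := by
  by_cases h : (d : ℤ) ∣ a
  · obtain ⟨b, rfl⟩ := h
    have hd' : (d : ℤ) ≠ 0 := by exact_mod_cast hd.ne'
    have hp' : (p : ℤ) ≠ 0 := by exact_mod_cast hp.ne'
    have h0 := Int.emod_nonneg b hp'
    have h1 := Int.emod_lt_of_pos b (by exact_mod_cast hp : (0 : ℤ) < p)
    rw [if_pos (dvd_mul_right _ _), Finset.sum_eq_single (b % p).toNat]
    · rw [if_pos]
      rw [Int.toNat_of_nonneg h0]
      push_cast
      rw [show (d : ℤ) * b - b % p * d = d * (b - b % p) by ring]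
      exact mul_dvd_mul_left _ (Int.dvd_self_sub_emod)
    · intro j hj hne
      rw [if_neg]
      intro hdvd
      push_cast at hdvd
      rw [show (d : ℤ) * b - j * d = d * (b - j) by ring] at hdvd
      have h2 := Int.dvd_of_mul_dvd_mul_left hd' hdvd
      have h3 : b % p = j % p := Int.emod_eq_emod_iff_emod_sub_eq_zero.2 (Int.emod_eq_zero_of_dvd h2)
      rw [Int.emod_eq_of_lt (a := (j : ℤ)) (by positivity)
        (by exact_mod_cast Finset.mem_range.1 hj)] at h3
      omega
    · intro hn
      exact absurd (Finset.mem_range.2 (by omega)) hn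
  · rw [if_neg h]
    refine Finset.sum_eq_zero fun j _ => if_neg fun hdvd => h ?_
    have h1 : (d : ℤ) ∣ a - j * d := (Int.natCast_dvd_natCast.2 (dvd_mul_right d p)).trans hdvd
    exact (dvd_sub_left (dvd_mul_left _ _)).1 h1

theorem residueCount_split (x : Position m) (Z : Finset (Fin m)) {d p : ℕ} (hd : 0 < d)
    (hp : 0 < p) (t : ℤ) :
    residueCount x Z d t =
      ∑ j ∈ Finset.range p, residueCount x Z (d * p) (t + j * d) := by
  simp only [residueCount]
  rw [Finset.sum_comm]
  refine Finset.sum_congr rfl fun i _ => ?_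
  rw [← sum_dvd_sub_mul hd hp]
  simp only [sub_sub]

/-- Hermite's identity. It makes the normalization in `charge` additive under refinement of residue
classes. -/
theorem sum_add_ediv {p : ℕ} (hp : 0 < p) (a : ℤ) :
    ∑ j ∈ Finset.range p, (a + j) / (p : ℤ) = a := by
  have hp' : (p : ℤ) ≠ 0 := by exact_mod_cast hp.ne'
  have step : ∀ a : ℤ, ∑ j ∈ Finset.range p, (a + 1 + j) / (p : ℤ) =
      ∑ j ∈ Finset.range p, (a + j) / (p : ℤ) + 1 := by
    intro a
    have h1 := Finset.sum_range_succ (fun j : ℕ => (a + j) / (p : ℤ)) p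
    have h2 := Finset.sum_range_succ' (fun j : ℕ => (a + j) / (p : ℤ)) p
    have h3 : (a + p) / (p : ℤ) = a / p + 1 := by
      rw [Int.add_ediv_of_dvd_right (dvd_refl _), Int.ediv_self hp']
    have h4 : ∀ j : ℕ, a + ((j + 1 : ℕ) : ℤ) = a + 1 + j := fun j => by push_cast; ring
    simp only [h4, Nat.cast_zero, add_zero] at h2
    linarith
  have h0 : ∑ j ∈ Finset.range p, ((0 : ℤ) + j) / (p : ℤ) = 0 := by
    refine Finset.sum_eq_zero fun j hj => ?_
    rw [zero_add]
    exact Int.ediv_eq_zero_of_lt (by positivity) (by exact_mod_cast Finset.mem_range.1 hj)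
  induction a using Int.induction_on with
  | zero => exact h0
  | succ n ih => rw [step, ih]
  | pred n ih =>
    have := step (-n - 1)
    rw [show (-(n : ℤ) - 1 + 1) = -n by ring, ih] at this
    linarith

theorem charge_split (x : Position m) {d p : ℕ} (hd : 0 < d) (hp : 0 < p) (t : ℤ) :
    charge x d t = ∑ j ∈ Finset.range p, charge x (d * p) (t + j * d) := by
  have hd' : (d : ℤ) ≠ 0 := by exact_mod_cast hd.ne'
  have h : ∀ j : ℕ, (t + j * d) / ((d * p : ℕ) : ℤ) = (t / d + j) / (p : ℤ) := by
    intro j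
    rw [Nat.cast_mul, ← Int.ediv_ediv_of_nonneg (by positivity),
      Int.add_mul_ediv_right _ _ hd']
  simp only [charge, Finset.sum_sub_distrib, h]
  rw [sum_add_ediv hp, ← residueCount_split x _ hd hp]

theorem charge_add_mul (x : Position m) {d : ℕ} (hd : 0 < d) (t a : ℤ) :
    charge x d (t + d * a) = charge x d t - a := by
  have hd' : (d : ℤ) ≠ 0 := by exact_mod_cast hd.ne'
  rw [charge, charge, Int.add_mul_ediv_left _ _ hd', residueCount_congr x _ (t := t)]
  · ring
  · simp

/-- A charge drops by one per period `d`; the drop cancels in the difference, so a surplus belongs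
to a residue class. -/
theorem surplus_congr (x : Position m) (q : ℕ) {d : ℕ} (hd : 0 < d) {s t : ℤ}
    (h : (d : ℤ) ∣ s - t) : surplus x q d s = surplus x q d t := by
  obtain ⟨a, ha⟩ := h
  rw [surplus, surplus, show s = t + d * a by linarith,
    show t + d * a - q = (t - q) + d * a by ring, charge_add_mul x hd, charge_add_mul x hd]
  ring

theorem surplus_split (x : Position m) (q : ℕ) {d p : ℕ} (hd : 0 < d) (hp : 0 < p) (t : ℤ) :
    surplus x q d t = ∑ j ∈ Finset.range p, surplus x q (d * p) (t + j * d) := by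
  rw [surplus, charge_split x hd hp, charge_split x hd hp, ← Finset.sum_sub_distrib]
  refine Finset.sum_congr rfl fun j _ => ?_
  rw [surplus]
  congr 2
  ring

/-- Telescoping. With `surplus_self` it shows that the surpluses around a cycle of `d / q` steps of
length `q` add up to `-1`. -/
theorem sum_surplus (x : Position m) (q d n : ℕ) (t : ℤ) :
    ∑ i ∈ Finset.range n, surplus x q d (t - i * q) = surplus x (n * q) d t := by
  induction n with
  | zero => simp [surplus]
  | succ n ih =>
    rw [Finset.sum_range_succ, ih]
    simp only [surplus]
    rw [show t - (n : ℤ) * q - q = t - ((n + 1) * q : ℕ) by push_cast; ring]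
    push_cast
    ring

theorem surplus_self (x : Position m) {d : ℕ} (hd : 0 < d) (t : ℤ) :
    surplus x d d t = -1 := by
  have := charge_add_mul x hd t (-1)
  rw [surplus, show t - (d : ℤ) = t + d * (-1) by ring, this]
  ring

theorem exists_of_surplus_pos {x : Position m} {q d : ℕ} {t : ℤ} (hd : 0 < d)
    (h : 0 < surplus x q d t) : ∃ i, (d : ℤ) ∣ (x i : ℤ) - t := by
  by_contra! hno
  have h0 : residueCount x Finset.univ d t = 0 :=
    Finset.sum_eq_zero fun i _ => if_neg (hno i)
  have h1 := residueCount_nonneg x Finset.univ d (t - q)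
  have h2 : (t - q) / (d : ℤ) ≤ t / d :=
    Int.ediv_le_ediv (by exact_mod_cast hd) (by linarith [Int.natCast_nonneg q])
  simp only [surplus, charge, h0] at h
  linarith

theorem residueCount_self_of_lt {x : Position m} {d : ℕ} (hx : ∀ j, x j < d) (i : Fin m)
    (Z : Finset (Fin m)) : residueCount x Z d (x i) = if i ∈ Z then 1 else 0 := by
  have : ∀ j, ((d : ℤ) ∣ (x j : ℤ) - x i) ↔ i = j := by
    intro j
    constructor
    · intro h
      have h1 := Int.eq_zero_of_abs_lt_dvd h (by
        have := hx i; have := hx j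
        rw [abs_lt]; constructor <;> omega)
      exact (x.injective (by omega)).symm
    · rintro rfl; simp
  simp [residueCount, this]

/-- As `d` exceeds all squares, the class of a coin contains no other coin, and the surplus is 1
minus the number of coins congruent to `x i - q` plus `⌊(x i - q) / d⌋`. Both corrections are
nonpositive, so positivity makes them vanish. -/
theorem removable_of_surplus_pos {x : Position m} {q d : ℕ} (hq : 0 < q) (hqd : q ≤ d)
    (hx : ∀ j, x j < d) {i : Fin m} (h : 0 < surplus x q d (x i)) :
    q ≤ x i ∧ (∀ j, x j ≠ x i - q) ∧ surplus x q d (x i) ≤ 1 := by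
  have hd : (0 : ℤ) < d := by exact_mod_cast hq.trans_le hqd
  have h0 := residueCount_self_of_lt hx i Finset.univ
  have h1 : (x i : ℤ) / d = 0 :=
    Int.ediv_eq_zero_of_lt (by positivity) (by exact_mod_cast hx i)
  have h2 := residueCount_nonneg x Finset.univ d (x i - q)
  simp only [surplus, charge, h0, h1, Finset.mem_univ, if_true] at h ⊢
  have hqi : q ≤ x i := by
    by_contra! hlt
    have : ((x i : ℤ) - q) / d < 0 := Int.ediv_neg_of_neg_of_pos (by omega) hd
    linarith
  have h3 : ((x i : ℤ) - q) / d = 0 :=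
    Int.ediv_eq_zero_of_lt (by omega) (by have := hx i; omega)
  refine ⟨hqi, fun j hj => ?_, by linarith⟩
  have h4 := residueCount_self_of_lt hx j Finset.univ
  rw [hj, Nat.cast_sub hqi] at h4
  simp only [h4, h3, Finset.mem_univ, if_true] at h
  omega

theorem exists_forall_lt_surplus {x : Position m} {q p : ℕ} (hp : 0 < p) (Z : Finset (Fin m))
    {d : ℕ} (hd : 0 < d) {t : ℤ} (h : residueCount x Z d t < surplus x q d t) :
    ∃ i, (d : ℤ) ∣ (x i : ℤ) - t ∧ ∀ n : ℕ,
      residueCount x Z (d * p ^ n) (x i) < surplus x q (d * p ^ n) (x i) := by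
  have key : ∀ (K d : ℕ) (t : ℤ), 0 < d → residueCount x Z d t < surplus x q d t →
      ∃ i, (d : ℤ) ∣ (x i : ℤ) - t ∧ ∀ n ≤ K,
        residueCount x Z (d * p ^ n) (x i) < surplus x q (d * p ^ n) (x i) := by
    intro K
    induction K with
    | zero =>
      intro d t hd h
      obtain ⟨i, hi⟩ := exists_of_surplus_pos hd ((residueCount_nonneg x Z d t).trans_lt h)
      refine ⟨i, hi, fun n hn => ?_⟩
      obtain rfl : n = 0 := by omega
      rwa [pow_zero, mul_one, residueCount_congr x Z hi, surplus_congr x q hd hi]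
    | succ K ih =>
      intro d t hd h
      rw [residueCount_split x Z hd hp, surplus_split x q hd hp] at h
      obtain ⟨j, -, hj⟩ := Finset.exists_lt_of_sum_lt h
      obtain ⟨i, hi, hi'⟩ := ih (d * p) (t + j * d) (Nat.mul_pos hd hp) hj
      have hdi : (d : ℤ) ∣ (x i : ℤ) - t := by
        have h1 : (d : ℤ) ∣ (x i : ℤ) - (t + j * d) :=
          (dvd_mul_right _ (p : ℤ)).trans (by exact_mod_cast hi)
        rw [← sub_sub] at h1
        exact (dvd_sub_left (dvd_mul_left _ _)).1 h1
      refine ⟨i, hdi, fun n hn => ?_⟩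
      rcases n with _ | n
      · rw [pow_zero, mul_one, residueCount_congr x Z hdi, surplus_congr x q hd hdi,
          residueCount_split x Z hd hp, surplus_split x q hd hp]
        exact h
      · have := hi' n (by omega)
        rwa [mul_assoc, ← pow_succ'] at this
  by_contra! hno
  choose! n hn using hno
  -- Each coin fails at some level `n i`; a descent past all these levels ends at a coin that cannot
  -- fail.
  obtain ⟨i, hi, hi'⟩ := key (Finset.univ.sup n) d t hd h
  exact absurd (hi' (n i) (Finset.le_sup (Finset.mem_univ i))) (not_lt.2 (hn i hi))

theorem exists_bound (x : Position m) {p : ℕ} (hp : 1 < p) (d a : ℕ) (hd : 0 < d) :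
    ∃ n, a ≤ d * p ^ n ∧ ∀ j, x j < d * p ^ n := by
  refine ⟨a + ∑ j, x j, ?_, fun j => ?_⟩
  · have := (Nat.lt_pow_self hp (n := a + ∑ j, x j)).trans_le (Nat.le_mul_of_pos_left _ hd)
    omega
  · have := (Nat.lt_pow_self hp (n := a + ∑ j, x j)).trans_le (Nat.le_mul_of_pos_left _ hd)
    have h2 := Finset.single_le_sum (f := x) (fun _ _ => Nat.zero_le _) (Finset.mem_univ j)
    omega

/-- The coins in `Z` can be moved down by `q`, and no residue class of a modulus `d * p ^ n`
contains more coins of `Z` than its surplus. -/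
structure IsMovable (p : ℕ) (x : Position m) (q d : ℕ) (t : ℤ) (Z : Finset (Fin m)) : Prop where
  dvd : ∀ i ∈ Z, (d : ℤ) ∣ (x i : ℤ) - t
  le : ∀ i ∈ Z, q ≤ x i
  vacant : ∀ i ∈ Z, ∀ j, x j ≠ x i - q
  count_le : ∀ i ∈ Z, ∀ n : ℕ,
    residueCount x Z (d * p ^ n) (x i) ≤ surplus x q (d * p ^ n) (x i)

theorem residueCount_of_forall_dvd {x : Position m} {Z : Finset (Fin m)} {d : ℕ} {t : ℤ}
    (h : ∀ i ∈ Z, (d : ℤ) ∣ (x i : ℤ) - t) : residueCount x Z d t = Z.card := by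
  rw [residueCount, Finset.sum_congr rfl fun i hi => if_pos (h i hi)]
  simp

/-- Greedy choice: while `Z` has fewer coins than the surplus, the descent finds a coin all of whose
classes have room for one more. -/
theorem exists_isMovable {x : Position m} {q p : ℕ} (hp : 1 < p) (hq : 0 < q)
    {d : ℕ} (hd : 0 < d) {t : ℤ} (z : ℕ) (hz : (z : ℤ) ≤ max (surplus x q d t) 0) :
    ∃ Z : Finset (Fin m), Z.card = z ∧ IsMovable p x q d t Z := by
  induction z with
  | zero => exact ⟨∅, rfl, by constructor <;> simp⟩
  | succ z ih =>
    obtain ⟨Z, hcard, hZ⟩ := ih (by push_cast at hz; linarith)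
    have hlt : residueCount x Z d t < surplus x q d t := by
      rw [residueCount_of_forall_dvd hZ.dvd, hcard]
      push_cast at hz
      rcases le_max_iff.1 hz with h | h <;> omega
    obtain ⟨i, hdi, hi⟩ := exists_forall_lt_surplus (p := p) (by omega) Z hd hlt
    obtain ⟨n, hn1, hn2⟩ := exists_bound x hp d q hd
    obtain ⟨hqi, hvac, hle⟩ := removable_of_surplus_pos hq hn1 hn2
      ((residueCount_nonneg _ _ _ _).trans_lt (hi n))
    -- At a modulus separating the coins, the surplus is at most 1, so strict inequality leaves no
    -- room for `i` in `Z`.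
    have hiZ : i ∉ Z := by
      intro hmem
      have := hi n
      rw [residueCount_self_of_lt hn2, if_pos hmem] at this
      omega
    refine ⟨insert i Z, by rw [Finset.card_insert_of_notMem hiZ, hcard], ?_, ?_, ?_, ?_⟩
    · simpa [hdi] using hZ.dvd
    · simpa [hqi] using hZ.le
    · simpa [hvac] using hZ.vacant
    · intro j hj n
      have hins : residueCount x (insert i Z) (d * p ^ n) (x j) =
          (if ((d * p ^ n : ℕ) : ℤ) ∣ (x i : ℤ) - x j then 1 else 0) +
            residueCount x Z (d * p ^ n) (x j) := Finset.sum_insert hiZ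
      rw [hins]
      have hpos : 0 < d * p ^ n := Nat.mul_pos hd (pow_pos (by omega) n)
      split_ifs with hdvd
      · rw [← residueCount_congr x Z hdvd, ← surplus_congr x q hpos hdvd]
        have := hi n
        omega
      · rcases Finset.mem_insert.1 hj with rfl | hj
        · simp at hdvd
        · simpa using hZ.count_le j hj n

end Residues

/-! ### Change of weights under moves, and positivity of core weights. -/

section Weights

variable {m : ℕ}

/-- The position obtained by moving the coins in `Z` down by `q`. -/
def lower (x : Position m) (q : ℕ) (Z : Finset (Fin m)) (hle : ∀ i ∈ Z, q ≤ x i)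
    (hvac : ∀ i ∈ Z, ∀ j, x j ≠ x i - q) : Position m where
  toFun i := if i ∈ Z then x i - q else x i
  inj' i j h := by
    simp only at h
    split_ifs at h with hi hj hj
    · have := hle i hi; have := hle j hj
      exact x.injective (by omega)
    · exact absurd h.symm (hvac i hi j)
    · exact absurd h (hvac j hj i)
    · exact x.injective h

/-- Pairs inside `Z` keep their congruence. A lowered coin loses its partners outside `Z` and gains
the coins congruent to `x i - q`, none of which lies in `Z` by `hne`. -/
theorem weight_lower {x : Position m} {q : ℕ} {Z : Finset (Fin m)} (hle : ∀ i ∈ Z, q ≤ x i)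
    (hvac : ∀ i ∈ Z, ∀ j, x j ≠ x i - q) {d : ℕ}
    (hne : ∀ i ∈ Z, ∀ j ∈ Z, ¬ (d : ℤ) ∣ (x j : ℤ) - (x i - q)) :
    weight (lower x q Z hle hvac) d = weight x d +
      ∑ i ∈ Z, (surplus x q d (x i) - residueCount x Z d (x i)) := by
  set y := lower x q Z hle hvac with hy
  have hyi : ∀ i, (y i : ℤ) = if i ∈ Z then (x i : ℤ) - q else x i := by
    intro i
    have : y i = if i ∈ Z then x i - q else x i := rfl
    rw [this]
    split_ifs with h
    · exact Nat.cast_sub (hle i h)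
    · rfl
  let g : ℤ → ℤ := fun a => if (d : ℤ) ∣ a then 1 else 0
  have gneg : ∀ a b, g (a - b) = g (b - a) := fun a b => by simp only [g, dvd_sub_comm]
  let F : Fin m → Fin m → ℤ := fun i j => if i ∈ Z then
    g (x j - (x i - q)) - (g (x j - x i) - if j ∈ Z then g (x j - x i) else 0) else 0
  have hF : ∀ i j, g (y j - y i) = g (x j - x i) + F i j + F j i := by
    intro i j
    rw [hyi, hyi]
    by_cases hi : i ∈ Z <;> by_cases hj : j ∈ Z <;> simp only [F, hi, hj, if_true, if_false]
    · have h1 : g ((x j : ℤ) - (x i - q)) = 0 := if_neg (hne i hi j hj)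
      have h2 : g ((x i : ℤ) - (x j - q)) = 0 := if_neg (hne j hj i hi)
      rw [h1, h2, show (x j : ℤ) - q - (x i - q) = x j - x i by ring]
      ring
    · ring
    · rw [gneg (x i : ℤ) (x j - q), gneg (x i : ℤ) (x j)]
      ring
    · ring
  have hres : ∀ (z : Position m) (Y : Finset (Fin m)) (t : ℤ),
      residueCount z Y d t = ∑ j ∈ Y, g (z j - t) := fun _ _ _ => rfl
  have hFsum : ∑ i, ∑ j, F i j = ∑ i ∈ Z, (residueCount x Finset.univ d (x i - q) -
      (residueCount x Finset.univ d (x i) - residueCount x Z d (x i))) := by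
    rw [← Finset.sum_filter_add_sum_filter_not _ (fun i => i ∈ Z)]
    have h0 : ∑ i ∈ Finset.univ.filter (fun i => i ∉ Z), ∑ j, F i j = 0 :=
      Finset.sum_eq_zero fun i hi => Finset.sum_eq_zero fun j _ =>
        if_neg (Finset.mem_filter.1 hi).2
    rw [h0, add_zero, Finset.filter_mem_eq_inter, Finset.univ_inter]
    refine Finset.sum_congr rfl fun i hi => ?_
    simp only [F, hi, if_true, Finset.sum_sub_distrib, hres]
    congr 2
    rw [← Finset.sum_filter, Finset.filter_mem_eq_inter, Finset.univ_inter]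
  have hpairs : ∑ i, residueCount y Finset.univ d (y i) =
      ∑ i, residueCount x Finset.univ d (x i) + 2 * ∑ i, ∑ j, F i j := by
    simp only [hres, hF, Finset.sum_add_distrib]
    rw [Finset.sum_comm (f := fun i j => F j i)]
    ring
  have hfloor : ∑ i, (y i : ℤ) / d = ∑ i, (x i : ℤ) / d +
      ∑ i ∈ Z, (((x i : ℤ) - q) / d - (x i : ℤ) / d) := by
    have h1 : ∑ i ∈ Z, (((x i : ℤ) - q) / d - (x i : ℤ) / d) =
        ∑ i, if i ∈ Z then (((x i : ℤ) - q) / d - (x i : ℤ) / d) else 0 := by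
      rw [← Finset.sum_filter, Finset.filter_mem_eq_inter, Finset.univ_inter]
    rw [h1, ← Finset.sum_add_distrib]
    refine Finset.sum_congr rfl fun i _ => ?_
    rw [hyi]
    split_ifs <;> ring
  have h1 := two_mul_weight y d
  have h2 := two_mul_weight x d
  rw [hpairs, hFsum, hfloor] at h1
  simp only [surplus, charge, Finset.sum_sub_distrib] at h1 ⊢
  linarith

/-- `y` is obtained from `x` by moving coins down by multiples of `q`. -/
def LeMod (q : ℕ) (y x : Position m) : Prop :=
  ∀ i, y i ≤ x i ∧ (q : ℤ) ∣ (x i : ℤ) - y i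

theorem LeMod.refl (q : ℕ) (x : Position m) : LeMod q x x := fun i => by simp

theorem LeMod.trans {q : ℕ} {x y z : Position m} (h : LeMod q x y) (h' : LeMod q y z) :
    LeMod q x z := fun i => ⟨(h i).1.trans (h' i).1, by
  have := dvd_add (h i).2 (h' i).2
  rwa [show (y i : ℤ) - x i + (z i - y i) = z i - x i by ring] at this⟩

theorem LeMod.of_dvd {d q : ℕ} {x y : Position m} (h : LeMod q x y) (hdq : d ∣ q) :
    LeMod d x y := fun i => ⟨(h i).1, (Int.natCast_dvd_natCast.2 hdq).trans (h i).2⟩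

theorem leMod_lower (x : Position m) (q : ℕ) (Z : Finset (Fin m)) (hle : ∀ i ∈ Z, q ≤ x i)
    (hvac : ∀ i ∈ Z, ∀ j, x j ≠ x i - q) : LeMod q (lower x q Z hle hvac) x := by
  intro i
  have : lower x q Z hle hvac i = if i ∈ Z then x i - q else x i := rfl
  rw [this]
  split_ifs with h
  · rw [Nat.cast_sub (hle i h)]
    simp
  · simp

/-- Residues modulo `d` are preserved, so the pair terms cancel and only the floors change. -/
theorem LeMod.mul_weight_sub {d : ℕ} {x y : Position m} (h : LeMod d y x) :
    d * (weight x d - weight y d) = ∑ i, ((x i : ℤ) - y i) := by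
  have h1 : ∀ i j, ((d : ℤ) ∣ (y i : ℤ) - y j) ↔ (d : ℤ) ∣ (x i : ℤ) - x j := by
    intro i j
    rw [show (x i : ℤ) - x j = (y i - y j) + ((x i - y i) - (x j - y j)) by ring]
    exact (dvd_add_left (dvd_sub (h i).2 (h j).2)).symm
  simp only [weight, h1, sub_sub_sub_cancel_right]
  rw [← Finset.sum_sub_distrib, Finset.mul_sum]
  refine Finset.sum_congr rfl fun i _ => ?_
  obtain ⟨a, ha⟩ := (h i).2
  rcases Nat.eq_zero_or_pos d with rfl | hd
  · simp at ha ⊢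
    omega
  · have hd' : (d : ℤ) ≠ 0 := by exact_mod_cast hd.ne'
    rw [show (x i : ℤ) = y i + d * a by linarith, Int.add_mul_ediv_left _ _ hd']
    ring

theorem LeMod.weight_sub {d n : ℕ} (hd : 0 < d) {x y : Position m} (h : LeMod (d * n) y x) :
    weight x d - weight y d = n * (weight x (d * n) - weight y (d * n)) := by
  have hd' : (d : ℤ) ≠ 0 := by exact_mod_cast hd.ne'
  have h1 := h.mul_weight_sub
  have h2 := (h.of_dvd (dvd_mul_right d n)).mul_weight_sub
  apply mul_left_cancel₀ hd'
  rw [h2, ← h1]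
  push_cast
  ring

/-- The total size of the `p`-cores of the components of the `d`-quotient of the Young diagram
of `x`. -/
def coreWeight (p : ℕ) (x : Position m) (d : ℕ) : ℤ := weight x d - p * weight x (d * p)

/-- With `v j` the coin counts of the `p` subclasses of a class, the right side is a sum of terms `a
* (a - 1)`, nonnegative at integers. -/
theorem sum_sq_sub_sq_sum (v : ℕ → ℤ) (p : ℕ) :
    p * ∑ j ∈ Finset.range p, v j ^ 2 - (∑ j ∈ Finset.range p, v j) ^ 2 +
        ∑ j ∈ Finset.range p, (2 * (j : ℤ) + 1 - p) * v j =
      ∑ k ∈ Finset.range p, ∑ j ∈ Finset.range k, (v j - v k) * (v j - v k - 1) := by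
  induction p with
  | zero => simp
  | succ p ih =>
    rw [Finset.sum_range_succ (fun k => ∑ j ∈ Finset.range k, (v j - v k) * (v j - v k - 1)), ← ih]
    simp only [Finset.sum_range_succ]
    have h1 : ∑ j ∈ Finset.range p, (v j - v p) * (v j - v p - 1) =
        ∑ j ∈ Finset.range p, v j ^ 2 - 2 * v p * ∑ j ∈ Finset.range p, v j
          - ∑ j ∈ Finset.range p, v j + p * (v p ^ 2 + v p) := by
      rw [Finset.mul_sum, ← Finset.sum_sub_distrib, ← Finset.sum_sub_distrib]
      have : (p : ℤ) * (v p ^ 2 + v p) = ∑ j ∈ Finset.range p, (v p ^ 2 + v p) := by simp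
      rw [this, ← Finset.sum_add_distrib]
      exact Finset.sum_congr rfl fun j _ => by ring
    have h2 : ∑ j ∈ Finset.range p, (2 * (j : ℤ) + 1 - ((p + 1 : ℕ) : ℤ)) * v j =
        ∑ j ∈ Finset.range p, (2 * (j : ℤ) + 1 - p) * v j - ∑ j ∈ Finset.range p, v j := by
      rw [← Finset.sum_sub_distrib]
      exact Finset.sum_congr rfl fun j _ => by push_cast; ring
    rw [h1, h2]
    push_cast
    ring

/-- A sum over the coins of a function of the residue of the square. -/
theorem sum_eq_sum_residueCount (x : Position m) {d p : ℕ} (hd : 0 < d) (hp : 0 < p)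
    (f : ℤ → ℤ) (hf : ∀ s t : ℤ, ((d * p : ℕ) : ℤ) ∣ s - t → f s = f t) :
    ∑ i, f (x i) = ∑ t ∈ Finset.range d, ∑ j ∈ Finset.range p,
      residueCount x Finset.univ (d * p) (t + j * d) * f (t + j * d) := by
  have hd' : (0 : ℤ) < d := by exact_mod_cast hd
  simp only [residueCount, Finset.sum_mul]
  rw [Finset.sum_congr rfl fun t _ => Finset.sum_comm, Finset.sum_comm]
  refine Finset.sum_congr rfl fun i _ => ?_
  have h1 : ∀ (t : ℕ), ∑ j ∈ Finset.range p,
      (if ((d * p : ℕ) : ℤ) ∣ (x i : ℤ) - (t + j * d) then (1 : ℤ) else 0) * f (t + j * d) =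
        (if (d : ℤ) ∣ (x i : ℤ) - t then 1 else 0) * f (x i) := by
    intro t
    rw [← sum_dvd_sub_mul hd hp, Finset.sum_mul]
    refine Finset.sum_congr rfl fun j _ => ?_
    rw [sub_sub]
    split_ifs with h
    · rw [hf _ _ h]
    · simp
  simp only [h1]
  rw [Finset.sum_eq_single (x i % d)]
  · rw [if_pos, one_mul]
    push_cast
    exact Int.dvd_self_sub_emod
  · intro t ht hne
    rw [if_neg, zero_mul]
    intro hdvd
    apply hne
    have h2 : (x i : ℤ) % d = t % d :=
      Int.emod_eq_emod_iff_emod_sub_eq_zero.2 (Int.emod_eq_zero_of_dvd hdvd)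
    norm_cast at h2
    rw [h2, Nat.mod_eq_of_lt (Finset.mem_range.1 ht)]
  · intro hn
    exact absurd (Finset.mem_range.2 (Nat.mod_lt _ hd)) hn

theorem two_mul_coreWeight (x : Position m) {d p : ℕ} (hd : 0 < d) (hp : 0 < p) :
    2 * coreWeight p x d = ∑ t ∈ Finset.range d, ∑ k ∈ Finset.range p, ∑ j ∈ Finset.range k,
      (residueCount x Finset.univ (d * p) (t + j * d) -
          residueCount x Finset.univ (d * p) (t + k * d)) *
        (residueCount x Finset.univ (d * p) (t + j * d) -
          residueCount x Finset.univ (d * p) (t + k * d) - 1) := by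
  have hd' : (0 : ℤ) < d := by exact_mod_cast hd
  have hp' : (0 : ℤ) < p := by exact_mod_cast hp
  simp only [← sum_sq_sub_sq_sum]
  -- This function yields the linear coefficients `2 * j + 1 - p` of `sum_sq_sub_sq_sum`.
  have e1 := sum_eq_sum_residueCount x hd hp (fun s => 2 * (s / d % p) + 1 - p)
    (by
      rintro s t ⟨a, ha⟩
      have : s / d = t / d + p * a := by
        rw [← Int.add_mul_ediv_left _ _ hd'.ne']
        congr 1
        push_cast at ha
        linarith
      simp only [this, Int.add_mul_emod_self_left])
  have e2 := sum_eq_sum_residueCount x hd hp (fun s => residueCount x Finset.univ d s)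
    (fun s t h => residueCount_congr x _ ((Int.natCast_dvd_natCast.2 (dvd_mul_right d p)).trans h))
  have e3 := sum_eq_sum_residueCount x hd hp (fun s => residueCount x Finset.univ (d * p) s)
    (fun s t h => residueCount_congr x _ h)
  have h1 : ∀ t ∈ Finset.range d, ∀ j ∈ Finset.range p,
      ((t : ℤ) + j * d) / d % p = j := by
    intro t ht j hj
    rw [Int.add_mul_ediv_right _ _ hd'.ne', Int.ediv_eq_zero_of_lt (by positivity)
      (by exact_mod_cast Finset.mem_range.1 ht), zero_add]
    exact Int.emod_eq_of_lt (by positivity) (by exact_mod_cast Finset.mem_range.1 hj)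
  have h2 : ∀ (t j : ℕ), residueCount x Finset.univ d ((t : ℤ) + j * d) =
      ∑ j ∈ Finset.range p, residueCount x Finset.univ (d * p) (t + j * d) := by
    intro t j
    rw [residueCount_congr x _ (t := (t : ℤ)) (by simp), residueCount_split x _ hd hp]
  have e1' : ∑ i, (2 * ((x i : ℤ) / d % p) + 1 - p) =
      ∑ t ∈ Finset.range d, ∑ j ∈ Finset.range p,
        (2 * (j : ℤ) + 1 - p) * residueCount x Finset.univ (d * p) (t + j * d) := by
    rw [e1]
    refine Finset.sum_congr rfl fun t ht => Finset.sum_congr rfl fun j hj => ?_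
    rw [h1 t ht j hj, mul_comm]
  have e2' : ∑ i, residueCount x Finset.univ d (x i) = ∑ t ∈ Finset.range d,
      (∑ j ∈ Finset.range p, residueCount x Finset.univ (d * p) (t + j * d)) ^ 2 := by
    rw [e2]
    refine Finset.sum_congr rfl fun t _ => ?_
    simp only [h2]
    rw [← Finset.sum_mul, sq]
  have e3' : ∑ i, residueCount x Finset.univ (d * p) (x i) = ∑ t ∈ Finset.range d,
      ∑ j ∈ Finset.range p, residueCount x Finset.univ (d * p) (t + j * d) ^ 2 := by
    rw [e3]
    exact Finset.sum_congr rfl fun t _ => Finset.sum_congr rfl fun j _ => by rw [sq]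
  rw [Finset.sum_add_distrib, Finset.sum_sub_distrib, ← e1', ← e2', ← Finset.mul_sum, ← e3']
  have h3 : ∀ i, (x i : ℤ) / d % p = (x i : ℤ) / d - p * ((x i : ℤ) / (d * p : ℕ)) := by
    intro i
    rw [Int.emod_def, Nat.cast_mul, Int.ediv_ediv_of_nonneg hd'.le]
  have w1 := two_mul_weight x d
  have w2 := two_mul_weight x (d * p)
  simp only [h3, Finset.sum_sub_distrib, Finset.sum_add_distrib, ← Finset.mul_sum,
    Finset.sum_const, Finset.card_univ, Fintype.card_fin, nsmul_eq_mul, mul_one]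
  rw [coreWeight, mul_sub, w1, mul_left_comm, w2]
  ring

theorem mul_sub_one_nonneg (a : ℤ) : 0 ≤ a * (a - 1) := by
  rcases le_or_gt a 0 with h | h
  · nlinarith
  · nlinarith

theorem coreWeight_nonneg (x : Position m) {d p : ℕ} (hd : 0 < d) (hp : 0 < p) :
    0 ≤ coreWeight p x d := by
  have := two_mul_coreWeight x hd hp
  have h2 : 0 ≤ 2 * coreWeight p x d := by
    rw [this]
    exact Finset.sum_nonneg fun t _ => Finset.sum_nonneg fun k _ => Finset.sum_nonneg fun j _ =>
      mul_sub_one_nonneg _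
  omega

/-- Otherwise charges never increase along steps of `d`, and they drop by exactly 1 over `p` steps.
All differences are then 0 or 1, so every term of `two_mul_coreWeight` vanishes. -/
theorem exists_surplus_pos {x : Position m} {d p : ℕ} (hd : 0 < d) (hp : 0 < p)
    (h : 0 < coreWeight p x d) : ∃ t, 0 < surplus x d (d * p) t := by
  by_contra! hno
  have h0 := two_mul_coreWeight x hd hp
  rw [Finset.sum_eq_zero] at h0
  · omega
  intro t ht
  refine Finset.sum_eq_zero fun k hk => Finset.sum_eq_zero fun j hj => ?_
  have hk := Finset.mem_range.1 hk
  have hj := Finset.mem_range.1 hj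
  have ht := Finset.mem_range.1 ht
  have hd' : (0 : ℤ) < d := by exact_mod_cast hd
  have hanti : ∀ n : ℕ, ∀ s : ℤ, charge x (d * p) (s + n * d) ≤ charge x (d * p) s := by
    intro n
    induction n with
    | zero => simp
    | succ n ih =>
      intro s
      have h1 := hno (s + (n + 1 : ℕ) * d)
      rw [surplus, show s + ((n + 1 : ℕ) : ℤ) * d - d = s + n * d by push_cast; ring] at h1
      have := ih s
      linarith
  have hdiv : ∀ k < p, residueCount x Finset.univ (d * p) (t + k * d) =
      charge x (d * p) (t + k * d) := by
    intro k hk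
    rw [charge, Int.ediv_eq_zero_of_lt (by positivity), sub_zero]
    have : t + k * d < d * p := by nlinarith
    exact_mod_cast this
  rw [hdiv j (by omega), hdiv k hk]
  have h1 := hanti (k - j) (t + j * d)
  have h2 := hanti (p - (k - j)) (t + k * d)
  rw [Nat.cast_sub hj.le, show (t : ℤ) + j * d + (k - j) * d = t + k * d by ring] at h1
  rw [Nat.cast_sub (by omega), Nat.cast_sub hj.le,
    show (t : ℤ) + k * d + (p - (k - j)) * d = t + j * d + (d * p : ℕ) * 1 by push_cast; ring,
    charge_add_mul x (Nat.mul_pos hd hp)] at h2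
  rcases (by omega : charge x (d * p) (t + j * d) - charge x (d * p) (t + k * d) = 0 ∨
    charge x (d * p) (t + j * d) - charge x (d * p) (t + k * d) - 1 = 0) with h | h
  · rw [h, zero_mul]
  · rw [h, mul_zero]

/-- If `n` residue classes modulo `d` have a nontrivial `p`-core, then the core weight is at
least `n`. -/
theorem card_le_coreWeight {x : Position m} {d p : ℕ} (hd : 0 < d) (hp : 0 < p) {T : Finset ℕ}
    (hT : T ⊆ Finset.range d)
    (h : ∀ t ∈ T, ∃ s : ℤ, (d : ℤ) ∣ s - t ∧ 0 < surplus x d (d * p) s) :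
    (T.card : ℤ) ≤ coreWeight p x d := by
  have h0 := two_mul_coreWeight x hd hp
  have hd' : (0 : ℤ) < d := by exact_mod_cast hd
  have hdp : 0 < d * p := Nat.mul_pos hd hp
  set G : ℕ → ℤ := fun t => ∑ k ∈ Finset.range p, ∑ j ∈ Finset.range k,
      (residueCount x Finset.univ (d * p) (t + j * d) -
          residueCount x Finset.univ (d * p) (t + k * d)) *
        (residueCount x Finset.univ (d * p) (t + j * d) -
          residueCount x Finset.univ (d * p) (t + k * d) - 1) with hG
  have hGnonneg : ∀ t, 0 ≤ G t := fun t =>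
    Finset.sum_nonneg fun k _ => Finset.sum_nonneg fun j _ => mul_sub_one_nonneg _
  -- A positive surplus gives a difference `a ≤ -1` of neighbouring counts or, when the step wraps
  -- around the cycle at `k = 0`, one with `a ≥ 2`. Either way `a * (a - 1) ≥ 2`.
  have hGpos : ∀ t ∈ T, 2 ≤ G t := by
    intro t htT
    obtain ⟨s, hs, hpos⟩ := h t htT
    have ht := Finset.mem_range.1 (hT htT)
    have hterm : ∀ k < p, ∀ j < k, (residueCount x Finset.univ (d * p) (t + j * d) -
          residueCount x Finset.univ (d * p) (t + k * d)) *
        (residueCount x Finset.univ (d * p) (t + j * d) -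
          residueCount x Finset.univ (d * p) (t + k * d) - 1) ≤ G t := by
      intro k hk j hj
      refine le_trans ?_ (Finset.single_le_sum
        (f := fun k => ∑ j ∈ Finset.range k, (residueCount x Finset.univ (d * p) (t + j * d) -
          residueCount x Finset.univ (d * p) (t + k * d)) *
        (residueCount x Finset.univ (d * p) (t + j * d) -
          residueCount x Finset.univ (d * p) (t + k * d) - 1))
        (fun k _ => Finset.sum_nonneg fun j _ => mul_sub_one_nonneg _) (Finset.mem_range.2 hk))
      exact Finset.single_le_sum (s := Finset.range k)
        (f := fun j : ℕ => (residueCount x Finset.univ (d * p) (t + j * d) -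
          residueCount x Finset.univ (d * p) (t + k * d)) *
        (residueCount x Finset.univ (d * p) (t + j * d) -
          residueCount x Finset.univ (d * p) (t + k * d) - 1))
        (fun j _ => mul_sub_one_nonneg _) (Finset.mem_range.2 hj)
    have hdiv : ∀ k < p, residueCount x Finset.univ (d * p) (t + k * d) =
        charge x (d * p) (t + k * d) := by
      intro k hk
      rw [charge, Int.ediv_eq_zero_of_lt (by positivity), sub_zero]
      have : t + k * d < d * p := by nlinarith
      exact_mod_cast this
    obtain ⟨a, ha⟩ := hs
    have hr0 := Int.emod_nonneg a (by positivity : (p : ℤ) ≠ 0)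
    have hr1 := Int.emod_lt_of_pos a (by positivity : (0 : ℤ) < p)
    obtain ⟨k, hk⟩ := Int.eq_ofNat_of_zero_le hr0
    have hkp : k < p := by omega
    have hsur : surplus x d (d * p) (t + k * d) = surplus x d (d * p) s := by
      refine surplus_congr x d hdp ⟨-(a / p), ?_⟩
      have := Int.emod_add_mul_ediv a p
      rw [hk] at this
      push_cast
      linear_combination (-1 : ℤ) * ha + d * this
    rw [← hsur, surplus] at hpos
    rcases Nat.eq_zero_or_pos k with rfl | hkpos
    · have e1 : charge x (d * p) (t + ((0 : ℕ) : ℤ) * d - d) =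
          charge x (d * p) (t + ((p - 1 : ℕ) : ℤ) * d) + 1 := by
        have := charge_add_mul x hdp (t + ((p - 1 : ℕ) : ℤ) * d) (-1)
        rw [Nat.cast_sub hp] at this ⊢
        rw [show (t : ℤ) + ((0 : ℕ) : ℤ) * d - d =
          t + (p - (1 : ℕ)) * d + (d * p : ℕ) * (-1) by push_cast; ring, this]
        ring
      rw [e1] at hpos
      rcases Nat.eq_zero_or_pos (p - 1) with hp1 | hp1
      · rw [hp1] at hpos
        omega
      · have := hterm (p - 1) (by omega) 0 hp1
        rw [hdiv _ (by omega), hdiv _ (by omega)] at this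
        nlinarith
    · have := hterm k hkp (k - 1) (by omega)
      rw [hdiv _ (by omega), hdiv _ (by omega)] at this
      rw [Nat.cast_sub hkpos, show (t : ℤ) + (k - (1 : ℕ)) * d = t + k * d - d by
        push_cast; ring] at this
      nlinarith
  have h1 : ∑ t ∈ T, (2 : ℤ) ≤ 2 * coreWeight p x d := by
    rw [h0]
    exact (Finset.sum_le_sum hGpos).trans
      (Finset.sum_le_sum_of_subset_of_nonneg hT fun t _ _ => hGnonneg t)
  rw [Finset.sum_const, nsmul_eq_mul] at h1
  linarith

end Weights

/-! ### Reaching prescribed weights by lowering coins. -/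

section Reduction

variable {m : ℕ}

theorem weight_eq_zero {x : Position m} {d : ℕ} (hx : ∀ i, x i < d) : weight x d = 0 := by
  have h1 : ∀ i, (x i : ℤ) / d = 0 := fun i =>
    Int.ediv_eq_zero_of_lt (by positivity) (by exact_mod_cast hx i)
  have h2 := two_mul_weight x d
  simp only [residueCount_self_of_lt hx, h1, Finset.mem_univ, if_true, Finset.sum_const,
    Finset.card_univ, Fintype.card_fin, nsmul_eq_mul, mul_one, mul_zero, zero_add] at h2
  linarith

theorem weight_eq_coreWeight_add (p : ℕ) (x : Position m) (q n : ℕ) :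
    weight x (q * p ^ n) = coreWeight p x (q * p ^ n) + p * weight x (q * p ^ (n + 1)) := by
  rw [coreWeight, pow_succ, mul_assoc]
  ring

theorem weight_lower_self {x : Position m} {q : ℕ} (hq : 0 < q) {Z : Finset (Fin m)}
    (hle : ∀ i ∈ Z, q ≤ x i) (hvac : ∀ i ∈ Z, ∀ j, x j ≠ x i - q) :
    weight (lower x q Z hle hvac) q = weight x q - Z.card := by
  have hq' : (q : ℤ) ≠ 0 := by exact_mod_cast hq.ne'
  have h := (leMod_lower x q Z hle hvac).mul_weight_sub
  have h1 : ∑ i, ((x i : ℤ) - lower x q Z hle hvac i) = q * Z.card := by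
    have : ∀ i, (x i : ℤ) - lower x q Z hle hvac i = if i ∈ Z then (q : ℤ) else 0 := by
      intro i
      have : lower x q Z hle hvac i = if i ∈ Z then x i - q else x i := rfl
      rw [this]
      split_ifs with h
      · rw [Nat.cast_sub (hle i h)]; ring
      · ring
    simp only [this, ← Finset.sum_filter, Finset.filter_mem_eq_inter, Finset.univ_inter,
      Finset.sum_const, nsmul_eq_mul]
    ring
  rw [h1] at h
  have := mul_left_cancel₀ hq' h
  linarith

theorem not_dvd_sub_sub {x : Position m} {q p d : ℕ} (hq : 0 < q) (hp : 1 < p)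
    (hd : q * p ∣ d) {i j : Fin m} (h : ((q * p : ℕ) : ℤ) ∣ (x i : ℤ) - x j) :
    ¬ (d : ℤ) ∣ (x j : ℤ) - (x i - q) := by
  intro h1
  have h2 := dvd_add ((Int.natCast_dvd_natCast.2 hd).trans h1) h
  rw [show (x j : ℤ) - (x i - q) + (x i - x j) = q by ring] at h2
  have := Nat.le_of_dvd hq (Int.natCast_dvd_natCast.1 h2)
  nlinarith

/-- In `weight_lower`, all `z` coins share one class modulo `q * p`; at finer levels `count_le`
makes each term nonnegative. -/
theorem exists_lower {x : Position m} {q p : ℕ} (hp : 1 < p) (hq : 0 < q) {t : ℤ} {z : ℕ}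
    (hz : (z : ℤ) ≤ surplus x q (q * p) t) :
    ∃ y : Position m, LeMod q y x ∧ weight y q = weight x q - z ∧
      weight y (q * p) = weight x (q * p) + z * (surplus x q (q * p) t - z) ∧
      ∀ n, weight x (q * p ^ (n + 1)) ≤ weight y (q * p ^ (n + 1)) := by
  have hqp : 0 < q * p := Nat.mul_pos hq (by omega)
  obtain ⟨Z, hcard, hZ⟩ := exists_isMovable hp hq hqp z (hz.trans (le_max_left _ _))
  have hw : ∀ n, weight (lower x q Z hZ.le hZ.vacant) (q * p * p ^ n) =
      weight x (q * p * p ^ n) + ∑ i ∈ Z,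
        (surplus x q (q * p * p ^ n) (x i) - residueCount x Z (q * p * p ^ n) (x i)) := by
    intro n
    refine weight_lower hZ.le hZ.vacant fun i hi j hj => ?_
    refine not_dvd_sub_sub hq hp (dvd_mul_right _ _) ?_
    have := dvd_sub (hZ.dvd i hi) (hZ.dvd j hj)
    rwa [sub_sub_sub_cancel_right] at this
  refine ⟨lower x q Z hZ.le hZ.vacant, leMod_lower _ _ _ _ _, ?_, ?_, fun n => ?_⟩
  · rw [weight_lower_self hq, hcard]
  · have := hw 0
    rw [pow_zero, mul_one] at this
    rw [this, Finset.sum_congr rfl fun i hi => by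
      rw [surplus_congr x q hqp (hZ.dvd i hi), residueCount_congr x Z (hZ.dvd i hi),
        residueCount_of_forall_dvd hZ.dvd, hcard], Finset.sum_const, hcard, nsmul_eq_mul]
  · have := hw n
    rw [mul_assoc, ← pow_succ'] at this
    rw [this]
    have h0 : 0 ≤ ∑ i ∈ Z, (surplus x q (q * p ^ (n + 1)) (x i) -
        residueCount x Z (q * p ^ (n + 1)) (x i)) := by
      refine Finset.sum_nonneg fun i hi => ?_
      have := hZ.count_le i hi n
      rw [mul_assoc, ← pow_succ'] at this
      linarith
    linarith

/-- If no weight of `y` from level `k` on is smaller than that of `x`, the weight at level `k` is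
not larger, and the core weights of `x` are less than `p`, then all these weights agree. -/
theorem weight_eq_of_le {x y : Position m} {q p : ℕ} (hp : 1 < p) (hq : 0 < q)
    {k : ℕ} (h0 : weight y (q * p ^ k) ≤ weight x (q * p ^ k))
    (hle : ∀ n, k ≤ n → weight x (q * p ^ n) ≤ weight y (q * p ^ n))
    (hred : ∀ n, k ≤ n → coreWeight p x (q * p ^ n) < p) (n : ℕ) (hn : k ≤ n) :
    weight y (q * p ^ n) = weight x (q * p ^ n) := by
  induction n, hn using Nat.le_induction with
  | base => exact le_antisymm h0 (hle k le_rfl)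
  | succ n hn ih =>
    refine le_antisymm ?_ (hle (n + 1) (by omega))
    have h1 := weight_eq_coreWeight_add p x q n
    have h2 := weight_eq_coreWeight_add p y q n
    have h3 := coreWeight_nonneg y (d := q * p ^ n) (p := p)
      (Nat.mul_pos hq (pow_pos (by omega) n)) (by omega)
    have h4 := hred n hn
    have hp' : (0 : ℤ) < p := by exact_mod_cast (by omega : 0 < p)
    -- An excess at level `n + 1` adds at least `p` to the weight of `y` at level `n`, more than the
    -- core weight of `x` there.
    by_contra! hlt
    nlinarith

/-- Lower as many coins as a positive surplus s: the change s(s - s) at level 1 is zero, hence the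
higher weights persist and the core weight c drops by s. Lowering one coin instead (`y₁`) would
leave core weight c - 1 - p(s - 1) ≥ 0. So c - s ≥ (p - 1)(s - 1), which settles s ≥ 2; for s = 1, c
≥ p suffices. -/
theorem exists_coreWeight_lt {x : Position m} {q p : ℕ} (hp : 1 < p) (hq : 0 < q)
    (hred : ∀ n, 1 ≤ n → coreWeight p x (q * p ^ n) < p) (hc : (p : ℤ) ≤ coreWeight p x q) :
    ∃ y : Position m, LeMod q y x ∧
      (∀ n, 1 ≤ n → weight y (q * p ^ n) = weight x (q * p ^ n)) ∧
      (p : ℤ) - 1 ≤ coreWeight p y q ∧ coreWeight p y q < coreWeight p x q := by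
  have hp' : (1 : ℤ) < p := by exact_mod_cast hp
  obtain ⟨t, ht⟩ := exists_surplus_pos hq (by omega : 0 < p) (by linarith)
  obtain ⟨z, hz⟩ := Int.eq_ofNat_of_zero_le ht.le
  have hz1 : 1 ≤ z := by omega
  obtain ⟨y₁, -, h1, h2, -⟩ := exists_lower (x := x) (t := t) hp hq (z := 1) (by omega)
  obtain ⟨y, hy, h3, h4, h5⟩ := exists_lower hp hq hz.ge
  rw [hz] at h2 h4
  rw [sub_self, mul_zero, add_zero] at h4
  have hw := weight_eq_of_le (x := x) (y := y) (k := 1) hp hq (by rw [pow_one]; exact h4.le)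
    (fun n hn => by obtain ⟨k, rfl⟩ := Nat.exists_eq_add_of_le' hn; exact h5 k) hred
  have h6 := coreWeight_nonneg y₁ hq (by omega : 0 < p)
  simp only [coreWeight, h1, h2] at h6 hc ⊢
  refine ⟨y, hy, hw, ?_⟩
  rw [h3, h4]
  push_cast at h6 ⊢
  refine ⟨?_, by omega⟩
  rcases (by omega : z = 1 ∨ 2 ≤ z) with rfl | hz2
  · push_cast; linarith
  · have : (2 : ℤ) ≤ z := by exact_mod_cast hz2
    nlinarith

theorem exists_coreWeight_lt_base {q p : ℕ} (hp : 1 < p) (hq : 0 < q) (x : Position m)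
    (hred : ∀ n, 1 ≤ n → coreWeight p x (q * p ^ n) < p) :
    ∃ y : Position m, LeMod q y x ∧
      (∀ n, 1 ≤ n → weight y (q * p ^ n) = weight x (q * p ^ n)) ∧
      min (coreWeight p x q) (p - 1) ≤ coreWeight p y q ∧ coreWeight p y q < p := by
  induction hc : (coreWeight p x q).toNat using Nat.strong_induction_on generalizing x with
  | _ c ih =>
  by_cases hlt : coreWeight p x q < p
  · exact ⟨x, LeMod.refl q x, fun _ _ => rfl, min_le_left _ _, hlt⟩
  · obtain ⟨y, hy, hyw, hy1, hy2⟩ := exists_coreWeight_lt hp hq hred (not_lt.1 hlt)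
    have hyc : ∀ n, 1 ≤ n → coreWeight p y (q * p ^ n) < p := by
      intro n hn
      have h1 := hred n hn
      have h2 := weight_eq_coreWeight_add p x q n
      have h3 := weight_eq_coreWeight_add p y q n
      rw [hyw n hn, hyw (n + 1) (by omega)] at h3
      linarith
    have := coreWeight_nonneg y hq (by omega : 0 < p)
    obtain ⟨z, hz, hzw, hz1, hz2⟩ := ih _ (by omega) y hyc rfl
    refine ⟨z, hz.trans hy, fun n hn => (hzw n hn).trans (hyw n hn), ?_, hz2⟩
    rw [min_eq_right hy1] at hz1
    exact (min_le_right _ _).trans hz1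

/-- Levels are treated from the top down. Moves by multiples of p^(N+1) do not affect the core
weight c at p^N, so c is still congruent to digit N of `g`. Reducing it to at least min(c, p - 1)
keeps it at least that digit. -/
theorem exists_reduced {p : ℕ} (hp : 1 < p) (x : Position m) (g : ℕ)
    (hg : ∀ n, (p : ℤ) ∣ weight x (p ^ n) - (g / p ^ n : ℕ)) (N : ℕ) :
    ∃ y : Position m, LeMod (p ^ N) y x ∧ (∀ n, coreWeight p y (p ^ N * p ^ n) < p) ∧
      ((g / p ^ N : ℕ) : ℤ) ≤ weight y (p ^ N) := by
  have hp' : (1 : ℤ) < p := by exact_mod_cast hp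
  obtain ⟨K, hK1, hK2⟩ := exists_bound x hp 1 (g + 1) one_pos
  simp only [one_mul] at hK1 hK2
  have key : ∀ k N, K ≤ N + k → ∃ y : Position m, LeMod (p ^ N) y x ∧
      (∀ n, coreWeight p y (p ^ N * p ^ n) < p) ∧
      ((g / p ^ N : ℕ) : ℤ) ≤ weight y (p ^ N) := by
    intro k
    induction k with
    | zero =>
      intro N hN
      have hpow : ∀ n, N ≤ n → p ^ K ≤ p ^ n := fun n hn => Nat.pow_le_pow_right (by omega) (by omega)
      have hw : ∀ n, N ≤ n → weight x (p ^ n) = 0 := fun n hn =>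
        weight_eq_zero fun i => (hK2 i).trans_le (hpow n hn)
      refine ⟨x, LeMod.refl _ x, fun n => ?_, ?_⟩
      · rw [coreWeight, ← pow_add, ← pow_succ, hw _ (by omega), hw _ (by omega)]
        linarith
      · rw [hw N le_rfl, Nat.div_eq_of_lt (by have := hpow N le_rfl; omega)]
        simp
    | succ k ih =>
      intro N hN
      have hpN : 0 < p ^ N := pow_pos (by omega) N
      obtain ⟨y₁, h1, h2, h3⟩ := ih (N + 1) (by omega)
      have hc1 : coreWeight p y₁ (p ^ N) = coreWeight p x (p ^ N) := by
        have := LeMod.weight_sub hpN (show LeMod (p ^ N * p) y₁ x by rwa [← pow_succ])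
        rw [coreWeight, coreWeight]
        linarith
      obtain ⟨y, hy, hyw, hy1, hy2⟩ := exists_coreWeight_lt_base hp hpN y₁ (by
        intro n hn
        obtain ⟨l, rfl⟩ := Nat.exists_eq_add_of_le' hn
        have := h2 l
        rwa [pow_succ, mul_assoc, ← pow_succ'] at this)
      refine ⟨y, hy.trans (h1.of_dvd (pow_dvd_pow p (by omega))), fun n => ?_, ?_⟩
      · rcases n with _ | n
        · simpa using hy2
        · have e1 := weight_eq_coreWeight_add p y₁ (p ^ N) (n + 1)
          have e2 := weight_eq_coreWeight_add p y (p ^ N) (n + 1)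
          rw [hyw _ (by omega), hyw _ (by omega)] at e2
          have := h2 n
          rw [show p ^ (N + 1) * p ^ n = p ^ N * p ^ (n + 1) by ring] at this
          linarith
      · have e1 := hyw 1 le_rfl
        rw [pow_one, ← pow_succ] at e1
        have e2 : weight y (p ^ N) = coreWeight p y (p ^ N) + p * weight y (p ^ (N + 1)) := by
          rw [coreWeight, pow_succ]; ring
        have e3 : g / p ^ N = g / p ^ N % p + p * (g / p ^ (N + 1)) := by
          rw [pow_succ, ← Nat.div_div_eq_div_mul, Nat.mod_add_div]
        rw [e2, e1, e3]
        push_cast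
        have e4 : ((g / p ^ N % p : ℕ) : ℤ) ≤ coreWeight p y (p ^ N) := by
          refine le_trans (le_min ?_ ?_) hy1
          · have hnn := coreWeight_nonneg y₁ hpN (by omega : 0 < p)
            have hmod : ((g / p ^ N % p : ℕ) : ℤ) = coreWeight p y₁ (p ^ N) % p := by
              rw [hc1, Int.natCast_mod, coreWeight, Int.sub_mul_emod_self_left]
              exact (Int.emod_eq_emod_iff_emod_sub_eq_zero.2
                (Int.emod_eq_zero_of_dvd (hg N))).symm
            rw [hmod]
            have h5 := Int.ediv_nonneg hnn (by omega : (0 : ℤ) ≤ p)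
            have h6 := Int.emod_add_mul_ediv (coreWeight p y₁ (p ^ N)) p
            nlinarith
          · have := Nat.mod_lt (g / p ^ N) (by omega : 0 < p)
            omega
        push_cast at e4 h3
        nlinarith
  exact key K N (by omega)

theorem exists_lower_single {x : Position m} {q p : ℕ} (hp : 1 < p) (hq : 0 < q) {k : ℕ} {t : ℤ}
    (ht : 0 < surplus x q (q * p ^ (k + 1)) t) :
    ∃ (i : Fin m) (y : Position m), LeMod q y x ∧ ((q * p ^ (k + 1) : ℕ) : ℤ) ∣ (x i : ℤ) - t ∧
      weight y q = weight x q - 1 ∧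
      (∀ n, 1 ≤ n → weight y (q * p ^ n) =
        weight x (q * p ^ n) + (surplus x q (q * p ^ n) (x i) - 1)) ∧
      ∀ n, k + 1 ≤ n → 0 < surplus x q (q * p ^ n) (x i) := by
  have hd : 0 < q * p ^ (k + 1) := Nat.mul_pos hq (pow_pos (by omega) _)
  obtain ⟨Z, hcard, hZ⟩ := exists_isMovable (x := x) (t := t) hp hq hd 1
    (le_max_of_le_left (by push_cast; omega))
  obtain ⟨i, rfl⟩ := Finset.card_eq_one.1 hcard
  have hi := Finset.mem_singleton_self i
  have hself : ∀ d, residueCount x {i} d (x i) = 1 := fun d => by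
    rw [residueCount, Finset.sum_singleton, if_pos (by simp)]
  refine ⟨i, lower x q {i} hZ.le hZ.vacant, leMod_lower _ _ _ _ _, hZ.dvd i hi, ?_, ?_, ?_⟩
  · rw [weight_lower_self hq]
    simp
  · intro n hn
    obtain ⟨n, rfl⟩ := Nat.exists_eq_add_of_le' hn
    rw [weight_lower hZ.le hZ.vacant]
    · rw [Finset.sum_singleton, hself]
    · intro i' hi' j hj
      rw [Finset.mem_singleton] at hi' hj
      subst hi' hj
      exact not_dvd_sub_sub hq hp (p := p)
        (by rw [pow_succ']; exact mul_dvd_mul_left _ (dvd_mul_right _ _)) (by simp)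
  · intro n hn
    obtain ⟨n, rfl⟩ := Nat.exists_eq_add_of_le hn
    have := hZ.count_le i hi n
    rw [hself, mul_assoc, ← pow_add] at this
    omega

/-- If the first `k` core weights vanish, then all surpluses up to level `k` are nonpositive. -/
theorem surplus_nonpos {x : Position m} {q p : ℕ} (hp : 1 < p) (hq : 0 < q) {k : ℕ}
    (h0 : ∀ n < k, coreWeight p x (q * p ^ n) = 0) {n : ℕ} (hn : n < k) (t : ℤ) :
    surplus x q (q * p ^ (n + 1)) t ≤ 0 := by
  by_contra! hpos
  have hp' : (0 : ℤ) < p := by exact_mod_cast (by omega : 0 < p)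
  obtain ⟨i, y, -, -, hw0, hw, hs⟩ := exists_lower_single hp hq hpos
  -- With zero core weights of `x`, the drop at level 0 propagates upwards; but at level `n + 1` the
  -- positive surplus forbids a drop.
  have key : ∀ l ≤ n + 1, weight y (q * p ^ l) < weight x (q * p ^ l) := by
    intro l
    induction l with
    | zero => intro _; simp [hw0]
    | succ l ih =>
      intro hl
      have h1 := ih (by omega)
      have h2 := weight_eq_coreWeight_add p x q l
      have h3 := weight_eq_coreWeight_add p y q l
      have h4 := coreWeight_nonneg y (d := q * p ^ l) (p := p)
        (Nat.mul_pos hq (pow_pos (by omega) l)) (by omega)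
      rw [h0 l (by omega)] at h2
      by_contra! hle
      nlinarith
  have h1 := key (n + 1) le_rfl
  have h2 := hw (n + 1) (by omega)
  have h3 := hs (n + 1) le_rfl
  omega

/-- This finds the class for a borrow: surplus zero at levels 1 to `k` means that lowering a coin
there drops each of these weights by exactly 1. If there were none, `p` different classes would
carry a nontrivial core at level `k`, forcing core weight at least `p`. -/
theorem exists_surplus_pos_of_coreWeight_lt {x : Position m} {q p : ℕ} (hp : 1 < p) (hq : 0 < q)
    {k : ℕ} (h0 : ∀ n < k, coreWeight p x (q * p ^ n) = 0)
    (hk0 : 0 < coreWeight p x (q * p ^ k)) (hkp : coreWeight p x (q * p ^ k) < p) :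
    ∃ t, 0 < surplus x q (q * p ^ (k + 1)) t ∧
      ∀ n, n < k → surplus x q (q * p ^ (n + 1)) t = 0 := by
  have hpos : ∀ n, 0 < q * p ^ n := fun n => Nat.mul_pos hq (pow_pos (by omega) n)
  have hle : ∀ n < k, ∀ t, surplus x q (q * p ^ (n + 1)) t ≤ 0 := fun n hn t =>
    surplus_nonpos hp hq h0 hn t
  have hsplit : ∀ n t, surplus x q (q * p ^ n) t = ∑ j ∈ Finset.range p,
      surplus x q (q * p ^ (n + 1)) (t + j * (q * p ^ n : ℕ)) := by
    intro n t
    rw [surplus_split x q (hpos n) (by omega : 0 < p), mul_assoc, ← pow_succ]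
  obtain ⟨s₀, hs₀⟩ := exists_surplus_pos (hpos k) (by omega : 0 < p) hk0
  rw [mul_assoc, ← pow_succ] at hs₀
  rcases Nat.eq_zero_or_pos k with rfl | hk
  · rw [pow_zero, mul_one] at hs₀
    exact ⟨s₀, hs₀, by simp⟩
  by_contra! hno
  have hcongr1 : ∀ (s : ℤ) (n : ℕ) (a : ℤ), 1 ≤ n →
      surplus x q (q * p ^ 1) (s + a * (q * p ^ n : ℕ)) = surplus x q (q * p ^ 1) s := by
    intro s n a hn
    refine surplus_congr x q (hpos 1) ?_
    rw [add_sub_cancel_left]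
    exact dvd_mul_of_dvd_right
      (Int.natCast_dvd_natCast.2 (mul_dvd_mul_left q (pow_dvd_pow p hn))) a
  have hzero : ∀ n < k, ∀ t, surplus x q (q * p ^ 1) t = 0 →
      surplus x q (q * p ^ (n + 1)) t = 0 := by
    intro n
    induction n with
    | zero => exact fun _ t ht => ht
    | succ n ih =>
      intro hn t ht
      have h1 := ih (by omega) t ht
      rw [hsplit, Finset.sum_eq_zero_iff_of_nonpos fun j _ => hle (n + 1) hn _] at h1
      simpa using h1 0 (Finset.mem_range.2 (by omega))
  have hnonpos : ∀ t, surplus x q (q * p ^ 1) t = 0 → surplus x q (q * p ^ (k + 1)) t ≤ 0 := by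
    intro t ht
    by_contra! hlt
    obtain ⟨n, hn, hne⟩ := hno t hlt
    exact hne (hzero n hn t ht)
  have htop : ∀ t, surplus x q (q * p ^ 1) t = 0 → surplus x q (q * p ^ (k + 1)) t = 0 := by
    intro t ht
    have h1 := hzero (k - 1) (by omega) t ht
    rw [Nat.sub_add_cancel hk, hsplit, Finset.sum_eq_zero_iff_of_nonpos fun (j : ℕ) _ =>
      hnonpos (t + j * (q * p ^ k : ℕ)) ((hcongr1 t k j hk).trans ht)] at h1
    simpa using h1 0 (Finset.mem_range.2 (by omega))
  -- All terms are nonpositive, so each cycle of `p` classes has exactly one with surplus `-1`, here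
  -- that of `u`; the others have 0.
  have hroot : ∀ t, ∑ i ∈ Finset.range p, surplus x q (q * p ^ 1) (t - i * q) = -1 := by
    intro t
    rw [sum_surplus, pow_one, mul_comm q p]
    exact surplus_self x (Nat.mul_pos (by omega) hq) t
  have hle1 : ∀ t, surplus x q (q * p ^ 1) t ≤ 0 := fun t => hle 0 hk t
  obtain ⟨a, ha, hane⟩ : ∃ a ∈ Finset.range p, surplus x q (q * p ^ 1) (s₀ - a * q) ≠ 0 := by
    by_contra! hall
    have := hroot s₀
    rw [Finset.sum_eq_zero hall] at this
    omega
  have hap := Finset.mem_range.1 ha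
  set u : ℤ := s₀ - a * q with hu
  have hother : ∀ b : ℕ, 0 < b → b < p → surplus x q (q * p ^ 1) (u + b * q) = 0 := by
    intro b hb hbp
    have h1 := hroot (u + b * q)
    have h2 : ∑ i ∈ ({0, b} : Finset ℕ), surplus x q (q * p ^ 1) (u + b * q - i * q) ≥ -1 := by
      have hsub : ({0, b} : Finset ℕ) ⊆ Finset.range p := by
        intro i hi
        simp only [Finset.mem_insert, Finset.mem_singleton] at hi
        exact Finset.mem_range.2 (by omega)
      rw [← Finset.sum_sdiff hsub] at h1
      have := Finset.sum_nonpos (s := Finset.range p \ {0, b})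
        fun i _ => hle1 (u + b * q - i * q)
      omega
    rw [Finset.sum_pair hb.ne] at h2
    simp only [Nat.cast_zero, zero_mul, sub_zero, add_sub_cancel_right] at h2
    have h3 := hle1 u
    have h4 := hle1 (u + b * q)
    omega
  -- Away from the class of `u`, a step of `q` leaves charges modulo `q * p ^ (k + 1)` unchanged, by
  -- `htop`.
  have hconst : ∀ b : ℕ, b < p → surplus x (q * p ^ k) (q * p ^ (k + 1)) (u + b * q) =
      surplus x (q * p ^ k) (q * p ^ (k + 1)) u := by
    intro b
    induction b with
    | zero => simp
    | succ b ih =>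
      intro hb
      rw [← ih (by omega)]
      have h1 := hother (b + 1) (by omega) hb
      have h2 := htop _ h1
      have h3 := htop (u + (b + 1 : ℕ) * q + (-1) * (q * p ^ k : ℕ))
        ((hcongr1 _ k (-1) hk).trans h1)
      simp only [surplus] at h2 h3 ⊢
      rw [show u + ((b + 1 : ℕ) : ℤ) * q - q = u + b * q by push_cast; ring] at h2
      rw [show u + ((b + 1 : ℕ) : ℤ) * q + (-1) * (q * p ^ k : ℕ) - q =
          u + b * q - (q * p ^ k : ℕ) by push_cast; ring,
        show u + ((b + 1 : ℕ) : ℤ) * q + (-1) * (q * p ^ k : ℕ) =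
          u + ((b + 1 : ℕ) : ℤ) * q - (q * p ^ k : ℕ) by ring] at h3
      linarith
  have hallpos : ∀ b < p, 0 < surplus x (q * p ^ k) (q * p ^ (k + 1)) (u + (b : ℕ) * q) := by
    intro b hb
    rw [hconst b hb, ← hconst a hap, hu, sub_add_cancel]
    exact hs₀
  have hD : (0 : ℤ) < (q * p ^ k : ℕ) := by exact_mod_cast hpos k
  have hemod : ∀ b : ℕ, (((u + b * q) % (q * p ^ k : ℕ)).toNat : ℤ) =
      (u + b * q) % (q * p ^ k : ℕ) := fun b => Int.toNat_of_nonneg (Int.emod_nonneg _ hD.ne')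
  have hinj : Set.InjOn (fun b : ℕ => ((u + b * q) % (q * p ^ k : ℕ)).toNat)
      (Finset.range p : Set ℕ) := by
    intro b hb b' hb' heq
    have hb := Finset.mem_range.1 (Finset.mem_coe.1 hb)
    have hb' := Finset.mem_range.1 (Finset.mem_coe.1 hb')
    have h1 : (u + b * q) % (q * p ^ k : ℕ) = (u + b' * q) % (q * p ^ k : ℕ) := by
      rw [← hemod b, ← hemod b']
      exact congrArg (Nat.cast (R := ℤ)) heq
    have h2 := Int.dvd_of_emod_eq_zero (Int.emod_eq_emod_iff_emod_sub_eq_zero.1 h1)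
    rw [show u + b * q - (u + b' * q) = q * ((b : ℤ) - b') by ring, Nat.cast_mul] at h2
    have h3 := Int.dvd_of_mul_dvd_mul_left (by exact_mod_cast hq.ne') h2
    have h4 : (p : ℤ) ∣ (b : ℤ) - b' :=
      (Int.natCast_dvd_natCast.2 (dvd_pow_self p hk.ne')).trans h3
    have h5 := Int.eq_zero_of_abs_lt_dvd h4 (by rw [abs_lt]; constructor <;> omega)
    omega
  have hcard := card_le_coreWeight (x := x) (hpos k) (by omega : 0 < p)
    (T := (Finset.range p).image fun b : ℕ => ((u + b * q) % (q * p ^ k : ℕ)).toNat)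
    (by
      intro s hs
      obtain ⟨b, -, rfl⟩ := Finset.mem_image.1 hs
      have h1 := Int.emod_lt_of_pos (u + b * q) hD
      have h2 := hemod b
      exact Finset.mem_range.2 (by omega))
    (by
      intro s hs
      obtain ⟨b, hb, rfl⟩ := Finset.mem_image.1 hs
      refine ⟨u + b * q, ?_, ?_⟩
      · rw [hemod]
        exact Int.dvd_self_sub_emod
      · rw [mul_assoc, ← pow_succ]
        exact hallpos b (Finset.mem_range.1 hb))
  rw [Finset.card_image_of_injOn hinj, Finset.card_range] at hcard
  omega

/-- Subtraction of 1 in base `p`: the zero core weights below the first nonzero one become `p - 1`,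
that one loses 1, and the rest persist. -/
theorem exists_weight_sub_one {x : Position m} {q p : ℕ} (hp : 1 < p) (hq : 0 < q)
    (hred : ∀ n, coreWeight p x (q * p ^ n) < p) (hw : 0 < weight x q) :
    ∃ y : Position m, LeMod q y x ∧ weight y q = weight x q - 1 ∧
      ∀ n, coreWeight p y (q * p ^ n) < p := by
  have hp' : (1 : ℤ) < p := by exact_mod_cast hp
  have hpos : ∀ n, 0 < q * p ^ n := fun n => Nat.mul_pos hq (pow_pos (by omega) n)
  have hex : ∃ n, coreWeight p x (q * p ^ n) ≠ 0 := by
    by_contra! hall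
    have key : ∀ n, 0 < weight x (q * p ^ n) := by
      intro n
      induction n with
      | zero => simpa using hw
      | succ n ih =>
        rw [weight_eq_coreWeight_add p x q n, hall n, zero_add] at ih
        exact pos_of_mul_pos_right ih (by omega)
    obtain ⟨n, -, hn⟩ := exists_bound x hp q 0 hq
    exact absurd (weight_eq_zero hn) (key n).ne'
  classical
  obtain ⟨k, hk, hmin⟩ : ∃ k, coreWeight p x (q * p ^ k) ≠ 0 ∧
      ∀ n < k, coreWeight p x (q * p ^ n) = 0 :=
    ⟨Nat.find hex, Nat.find_spec hex, fun n hn => not_not.1 (Nat.find_min hex hn)⟩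
  have hk0 : 0 < coreWeight p x (q * p ^ k) :=
    lt_of_le_of_ne (coreWeight_nonneg x (hpos k) (by omega)) hk.symm
  obtain ⟨t, ht, ht0⟩ := exists_surplus_pos_of_coreWeight_lt hp hq hmin hk0 (hred k)
  obtain ⟨i, y, hy, hti, hw0, hwn, hs⟩ := exists_lower_single hp hq ht
  have hlow : ∀ n ≤ k, weight y (q * p ^ n) = weight x (q * p ^ n) - 1 := by
    intro n hn
    rcases n with _ | n
    · simpa using hw0
    · rw [hwn _ (by omega), surplus_congr x q (hpos _) (t := t), ht0 n (by omega)]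
      · ring
      · exact (Int.natCast_dvd_natCast.2 (mul_dvd_mul_left q (pow_dvd_pow p (by omega)))).trans hti
  have hge : ∀ n, k + 1 ≤ n → weight x (q * p ^ n) ≤ weight y (q * p ^ n) := by
    intro n hn
    have := hs n hn
    rw [hwn n (by omega)]
    omega
  have hk1 : weight y (q * p ^ (k + 1)) ≤ weight x (q * p ^ (k + 1)) := by
    have h1 := weight_eq_coreWeight_add p x q k
    have h2 := weight_eq_coreWeight_add p y q k
    have h3 := coreWeight_nonneg y (hpos k) (by omega : 0 < p)
    have h4 := hred k
    rw [hlow k le_rfl] at h2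
    by_contra! hlt
    nlinarith
  have hhigh := weight_eq_of_le hp hq hk1 hge fun n _ => hred n
  refine ⟨y, hy, hw0, fun n => ?_⟩
  have h1 := weight_eq_coreWeight_add p x q n
  have h2 := weight_eq_coreWeight_add p y q n
  rcases lt_trichotomy n k with h | rfl | h
  · rw [hlow n h.le, hlow (n + 1) h] at h2
    rw [hmin n h] at h1
    linarith
  · rw [hlow n le_rfl, hhigh (n + 1) le_rfl] at h2
    have := hred n
    linarith
  · rw [hhigh n h, hhigh (n + 1) (by omega)] at h2
    have := hred n
    linarith

theorem exists_weight_eq_div {p : ℕ} (hp : 1 < p) (x : Position m) (g : ℕ)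
    (hg : ∀ n, (p : ℤ) ∣ weight x (p ^ n) - (g / p ^ n : ℕ)) (N a : ℕ) (ha : a ≤ g / p ^ N) :
    ∃ y : Position m, LeMod (p ^ N) y x ∧ ∀ n, weight y (p ^ (N + n)) = (a / p ^ n : ℕ) := by
  have hpN : 0 < p ^ N := pow_pos (by omega) N
  have hp' : (0 : ℤ) < p := by exact_mod_cast (by omega : 0 < p)
  obtain ⟨x₁, h1, h2, h3⟩ := exists_reduced hp x g hg N
  have key : ∀ (k : ℕ), (a : ℤ) ≤ weight x₁ (p ^ N) - k → ∃ y : Position m, LeMod (p ^ N) y x₁ ∧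
      weight y (p ^ N) = weight x₁ (p ^ N) - k ∧ ∀ n, coreWeight p y (p ^ N * p ^ n) < p := by
    intro k
    induction k with
    | zero => exact fun _ => ⟨x₁, LeMod.refl _ _, by simp, h2⟩
    | succ k ih =>
      intro hk
      push_cast at hk
      obtain ⟨y, hy, hyw, hyr⟩ := ih (by linarith)
      obtain ⟨z, hz, hzw, hzr⟩ := exists_weight_sub_one hp hpN hyr (by linarith [Int.natCast_nonneg a])
      exact ⟨z, hz.trans hy, by rw [hzw, hyw]; push_cast; ring, hzr⟩
  have ha' : (a : ℤ) ≤ weight x₁ (p ^ N) := le_trans (by exact_mod_cast ha) h3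
  obtain ⟨k, hk⟩ := Int.eq_ofNat_of_zero_le (sub_nonneg.2 ha')
  obtain ⟨y, hy, hyw, hyr⟩ := key k (by omega)
  refine ⟨y, hy.trans h1, fun n => ?_⟩
  rw [pow_add]
  -- A core weight in `[0, p)` is the remainder of a weight divided by `p`, and the next weight is
  -- the quotient.
  induction n with
  | zero => simp; omega
  | succ n ih =>
    have e1 := weight_eq_coreWeight_add p y (p ^ N) n
    have e2 := coreWeight_nonneg y (d := p ^ N * p ^ n) (p := p)
      (Nat.mul_pos hpN (pow_pos (by omega) n)) (by omega)
    have e3 := hyr n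
    rw [ih] at e1
    rw [pow_succ p n, ← Nat.div_div_eq_div_mul, Int.natCast_div, e1, ← pow_succ,
      Int.add_mul_ediv_left _ _ hp'.ne', Int.ediv_eq_zero_of_lt e2 e3, zero_add]

end Reduction

/-! ### Hook lengths in terms of coins. -/

section Hooks

variable {m : ℕ}

theorem ediv_sub_ediv_sub_one {d : ℤ} (hd : 0 < d) (x : ℤ) :
    x / d - (x - 1) / d = if d ∣ x then 1 else 0 := by
  have h := Int.emod_add_mul_ediv x d
  have h0 := Int.emod_nonneg x hd.ne'
  have h1 := Int.emod_lt_of_pos x hd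
  split_ifs with hdvd
  · have h2 : (x - 1) / d = x / d - 1 := by
      rw [Int.emod_eq_zero_of_dvd hdvd, zero_add] at h
      have : x - 1 = (d - 1) + d * (x / d - 1) := by rw [mul_sub, h]; ring
      rw [this, Int.add_mul_ediv_left _ _ hd.ne', Int.ediv_eq_zero_of_lt (by omega) (by omega)]
      ring
    rw [h2]
    ring
  · have hne : x % d ≠ 0 := fun h => hdvd (Int.dvd_of_emod_eq_zero h)
    have h2 : (x - 1) / d = x / d := by
      have : x - 1 = (x % d - 1) + d * (x / d) := by linarith
      rw [this, Int.add_mul_ediv_left _ _ hd.ne', Int.ediv_eq_zero_of_lt (by omega) (by omega),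
        zero_add]
    rw [h2, sub_self]

theorem carryfreeN_apply {p : ℕ} (hp : 0 < p) (x : ℤ) (L : ℕ) :
    carryfreeN p x L = (((if ((p ^ L : ℕ) : ℤ) ∣ x then 1 else 0) : ℤ) : ZMod p) := by
  have hd : (0 : ℤ) < (p ^ L : ℕ) := by exact_mod_cast pow_pos hp L
  rw [← ediv_sub_ediv_sub_one hd]
  simp [carryfreeN, digits]

/-- The number of coins on the squares below `y`. -/
def countBelow (x : Position m) (y : ℕ) : ℕ :=
  (Finset.univ.filter fun l : Fin m => sorted x l < y).card

theorem countBelow_le_add (x : Position m) (a b : ℕ) :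
    countBelow x b ≤ countBelow x a + (b - a) := by
  have h1 : (Finset.univ.filter fun l : Fin m => a ≤ sorted x l ∧ sorted x l < b).card ≤
      (Finset.Ico a b).card :=
    Finset.card_le_card_of_injOn (sorted x) (fun l hl => by simpa using hl)
      (sorted_strictAnti x).injective.injOn
  rw [Nat.card_Ico] at h1
  refine le_trans ?_ (Nat.add_le_add_left h1 _)
  refine le_trans (Finset.card_le_card ?_) (Finset.card_union_le _ _)
  intro l hl
  simp only [Finset.mem_filter, Finset.mem_union, Finset.mem_univ, true_and] at hl ⊢
  omega

theorem countBelow_le (x : Position m) (y : ℕ) : countBelow x y ≤ y := by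
  have h := countBelow_le_add x 0 y
  have h0 : countBelow x 0 = 0 := by simp [countBelow]
  omega

theorem countBelow_succ {x : Position m} {y : ℕ} (hy : ∀ l, sorted x l ≠ y) :
    countBelow x (y + 1) = countBelow x y := by
  unfold countBelow
  congr 1
  ext l
  have := hy l
  simp only [Finset.mem_filter, Finset.mem_univ, true_and]
  omega

theorem countBelow_sorted (x : Position m) (i : Fin m) :
    countBelow x (sorted x i) = m - 1 - i := by
  unfold countBelow
  simp only [(sorted_strictAnti x).lt_iff_gt]
  rw [← Fin.card_Ioi i]
  congr 1
  ext l
  simp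

theorem countBelow_sorted_eq_add {x : Position m} {y : ℕ} (hy : ∀ l, sorted x l ≠ y) {i : Fin m}
    (hi : y < sorted x i) : countBelow x (sorted x i) =
      countBelow x y + (Finset.univ.filter fun l : Fin m => i < l ∧ y < sorted x l).card := by
  unfold countBelow
  rw [← Finset.card_union_of_disjoint]
  · congr 1
    ext l
    have h1 := hy l
    have h2 := (sorted_strictAnti x).lt_iff_gt (a := l) (b := i)
    simp only [Finset.mem_filter, Finset.mem_union, Finset.mem_univ, true_and]
    rw [← h2]
    omega
  · rw [Finset.disjoint_filter]
    intro l _ h1 h2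
    omega

/-- Empty squares `y` index columns by `y - countBelow x y`; a row meets that column iff its coin
lies above `y`. -/
theorem lt_rowLen_iff {x : Position m} {y : ℕ} (hy : ∀ l, sorted x l ≠ y) (l : Fin m) :
    y - countBelow x y < sorted x l - (m - 1 - l) ↔ y < sorted x l := by
  have h1 := countBelow_le x y
  have h2 := countBelow_le x (sorted x l)
  rw [← countBelow_sorted x]
  constructor
  · intro h
    by_contra! hle
    have := countBelow_le_add x (sorted x l) y
    omega
  · intro h
    have := countBelow_le_add x (y + 1) (sorted x l)
    rw [countBelow_succ hy] at this
    omega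

theorem mem_diagram {x : Position m} {a b : ℕ} : (a, b) ∈ (diagram x).cells ↔
    ∃ i : Fin m, (i : ℕ) = a ∧ b < sorted x i - (m - 1 - i) := by
  simp [diagram, Finset.mem_biUnion, Finset.mem_image]
  constructor
  · rintro ⟨i, hb, rfl⟩; exact ⟨i, rfl, hb⟩
  · rintro ⟨i, rfl, hb⟩; exact ⟨i, hb, rfl⟩

theorem card_hook (x : Position m) (i : Fin m) (b : ℕ) (hb : b < sorted x i - (m - 1 - i)) :
    (hook (diagram x) (i, b)).card = sorted x i - (m - 1 - i) - b +
      (Finset.univ.filter fun l : Fin m => i < l ∧ b < sorted x l - (m - 1 - l)).card := by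
  have h : hook (diagram x) (i, b) =
      ((Finset.Ico b (sorted x i - (m - 1 - i))).image fun c => ((i : ℕ), c)) ∪
        ((Finset.univ.filter fun l : Fin m => i < l ∧ b < sorted x l - (m - 1 - l)).image
          fun l : Fin m => ((l : ℕ), b)) := by
    ext ⟨a, c⟩
    simp only [hook, Finset.mem_filter, mem_diagram, Finset.mem_union, Finset.mem_image,
      Finset.mem_Ico, Finset.mem_univ, true_and, Prod.mk.injEq]
    constructor
    · rintro ⟨⟨l, rfl, hl⟩, ⟨h1, rfl⟩ | ⟨h1, h2⟩⟩
      · rcases h1.eq_or_lt with h1 | h1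
        · obtain rfl := Fin.ext h1
          exact Or.inl ⟨c, ⟨le_rfl, hl⟩, rfl, rfl⟩
        · exact Or.inr ⟨l, ⟨h1, hl⟩, rfl, rfl⟩
      · obtain rfl := Fin.ext h1
        exact Or.inl ⟨c, ⟨h2, hl⟩, rfl, rfl⟩
    · rintro (⟨c, ⟨h1, h2⟩, rfl, rfl⟩ | ⟨l, ⟨h1, h2⟩, rfl, rfl⟩)
      · exact ⟨⟨i, rfl, h2⟩, Or.inr ⟨rfl, h1⟩⟩
      · exact ⟨⟨l, rfl, h2⟩, Or.inl ⟨le_of_lt h1, rfl⟩⟩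
  rw [h, Finset.card_union_of_disjoint, Finset.card_image_of_injective, Finset.card_image_of_injective,
    Nat.card_Ico]
  · intro l l' h
    exact Fin.ext (Prod.mk.inj h).1
  · intro c c' h
    exact (Prod.mk.inj h).2
  · rw [Finset.disjoint_left]
    rintro ⟨a, c⟩ h1 h2
    simp only [Finset.mem_image, Finset.mem_filter, Finset.mem_univ, true_and,
      Prod.mk.injEq] at h1 h2
    obtain ⟨_, -, rfl, rfl⟩ := h1
    obtain ⟨l, ⟨hl, -⟩, h3, -⟩ := h2
    exact hl.ne' (Fin.ext h3)

/-- The hook lengths in row `i` are the numbers `1, …, xᵢ` other than the differences `xᵢ - xₗ`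
with `l > i`. -/
theorem sum_row_hook (x : Position m) (i : Fin m) (g : ℕ → ℤ) :
    ∑ b ∈ Finset.range (sorted x i - (m - 1 - i)), g (hook (diagram x) (i, b)).card +
        ∑ l ∈ Finset.univ.filter (fun l => i < l), g (sorted x i - sorted x l) =
      ∑ h ∈ Finset.range (sorted x i), g (h + 1) := by
  have hinj := (sorted_strictAnti x).injective
  have hlt : ∀ l, sorted x l < sorted x i ↔ i < l := fun l => (sorted_strictAnti x).lt_iff_gt
  set S : Finset ℕ := (Finset.univ.filter fun l => i < l).image (sorted x) with hS
  have hSsub : S ⊆ Finset.range (sorted x i) := by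
    intro y hy
    obtain ⟨l, hl, rfl⟩ := Finset.mem_image.1 hy
    exact Finset.mem_range.2 ((hlt l).2 (Finset.mem_filter.1 hl).2)
  have hgap : ∀ y ∈ Finset.range (sorted x i) \ S, y < sorted x i ∧ ∀ l, sorted x l ≠ y := by
    intro y hy
    obtain ⟨h1, h2⟩ := Finset.mem_sdiff.1 hy
    have h1 := Finset.mem_range.1 h1
    refine ⟨h1, fun l hl => h2 (Finset.mem_image.2 ⟨l, ?_, hl⟩)⟩
    rw [← hl, hlt] at h1
    simpa using h1
  -- The cell in the column of an empty square `y` has hook length `sorted x i - y`.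
  have hrow : ∑ y ∈ Finset.range (sorted x i) \ S, g (sorted x i - y) =
      ∑ b ∈ Finset.range (sorted x i - (m - 1 - i)), g (hook (diagram x) (i, b)).card := by
    have hmaps : Set.MapsTo (fun y => y - countBelow x y)
        (Finset.range (sorted x i) \ S : Finset ℕ)
        (Finset.range (sorted x i - (m - 1 - i)) : Finset ℕ) := by
      intro y hy
      obtain ⟨h1, h2⟩ := hgap y hy
      simpa using (lt_rowLen_iff h2 i).2 h1
    have hmono : ∀ y y', (∀ l, sorted x l ≠ y) → y < y' →
        y - countBelow x y < y' - countBelow x y' := by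
      intro y y' hy hyy
      have h1 := countBelow_le_add x (y + 1) y'
      rw [countBelow_succ hy] at h1
      have := countBelow_le x y
      have := countBelow_le x y'
      omega
    have hinj' : Set.InjOn (fun y => y - countBelow x y)
        (Finset.range (sorted x i) \ S : Finset ℕ) := by
      intro y hy y' hy' heq
      simp only at heq
      rcases lt_trichotomy y y' with h | h | h
      · have := hmono y y' (hgap y hy).2 h; omega
      · exact h
      · have := hmono y' y (hgap y' hy').2 h; omega
    refine Finset.sum_nbij (fun y => y - countBelow x y) hmaps hinj'
      (Finset.surjOn_of_injOn_of_card_le _ hmaps hinj' ?_) ?_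
    · rw [Finset.card_sdiff_of_subset hSsub, Finset.card_range, Finset.card_range, hS,
        Finset.card_image_of_injective _ hinj, ← countBelow_sorted x]
      simp only [countBelow, hlt]
      exact le_rfl
    · intro y hy
      obtain ⟨h1, h2⟩ := hgap y hy
      have h3 := (lt_rowLen_iff h2 i).2 h1
      rw [card_hook x i _ h3]
      simp only [lt_rowLen_iff h2]
      have h4 := countBelow_sorted_eq_add h2 h1
      have h5 := countBelow_le x y
      rw [countBelow_sorted] at h4
      congr 1
      omega
  rw [← hrow, ← Finset.sum_range_reflect (fun h => g (h + 1)), ← Finset.sum_sdiff hSsub]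
  have hrefl : ∀ y ∈ Finset.range (sorted x i),
      g (sorted x i - y) = g (sorted x i - 1 - y + 1) := by
    intro y hy
    have := Finset.mem_range.1 hy
    congr 1
    omega
  congr 1
  · exact Finset.sum_congr rfl fun y hy => hrefl y (Finset.mem_sdiff.1 hy).1
  · rw [hS, Finset.sum_image hinj.injOn]
    refine Finset.sum_congr rfl fun l hl => hrefl _ ?_
    exact hSsub (Finset.mem_image_of_mem _ hl)

theorem sum_cells (x : Position m) (f : ℕ × ℕ → ℤ) : ∑ c ∈ (diagram x).cells, f c =
    ∑ i : Fin m, ∑ b ∈ Finset.range (sorted x i - (m - 1 - i)), f (i, b) := by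
  change ∑ c ∈ Finset.univ.biUnion _, f c = _
  rw [Finset.sum_biUnion]
  · refine Finset.sum_congr rfl fun i _ => ?_
    rw [Finset.sum_image]
    intro b _ b' _ h
    exact (Prod.mk.inj h).2
  · intro i _ j _ hij
    simp only [Function.onFun]
    rw [Finset.disjoint_left]
    rintro ⟨a, c⟩ h1 h2
    simp only [Finset.mem_image, Prod.mk.injEq] at h1 h2
    obtain ⟨_, -, rfl, -⟩ := h1
    obtain ⟨_, -, h3, -⟩ := h2
    exact hij (Fin.ext h3.symm)

/-- The permutation sorting the coordinates of a position in decreasing order. -/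
def sortPerm (x : Position m) : Equiv.Perm (Fin m) := Fin.revPerm.trans (Tuple.sort (⇑x))

theorem sorted_eq (x : Position m) (i : Fin m) : sorted x i = x (sortPerm x i) := rfl

theorem weight_perm (x : Position m) (σ : Equiv.Perm (Fin m)) (d : ℕ) :
    weight (σ.toEmbedding.trans x) d = weight x d := by
  have h1 := two_mul_weight x d
  have h2 := two_mul_weight (σ.toEmbedding.trans x) d
  have h3 : ∀ t, residueCount (σ.toEmbedding.trans x) Finset.univ d t =
      residueCount x Finset.univ d t := fun t =>
    Equiv.sum_comp σ fun i => if (d : ℤ) ∣ (x i : ℤ) - t then (1 : ℤ) else 0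
  have h4 : ∑ i, ((σ.toEmbedding.trans x) i : ℤ) / d = ∑ i, (x i : ℤ) / d :=
    Equiv.sum_comp σ fun i => (x i : ℤ) / d
  have h5 : ∑ i, residueCount x Finset.univ d ((σ.toEmbedding.trans x) i) =
      ∑ i, residueCount x Finset.univ d (x i) :=
    Equiv.sum_comp σ fun i => residueCount x Finset.univ d (x i)
  simp only [h3, h4, h5] at h2
  linarith

theorem sum_hook_dvd (x : Position m) (d : ℕ) :
    (∑ c ∈ (diagram x).cells, if (d : ℤ) ∣ ((hook (diagram x) c).card : ℤ) then (1 : ℤ) else 0) =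
      weight x d := by
  rw [← weight_perm x (sortPerm x), sum_cells, weight, ← Finset.sum_sub_distrib]
  refine Finset.sum_congr rfl fun i _ => ?_
  have h := sum_row_hook x i fun h => if (d : ℤ) ∣ (h : ℤ) then 1 else 0
  have h1 : (∑ h ∈ Finset.range (sorted x i), if (d : ℤ) ∣ ((h + 1 : ℕ) : ℤ) then (1 : ℤ) else 0) =
      ((sorted x i / d : ℕ) : ℤ) := by
    rw [← Nat.card_multiples, Finset.card_filter]
    push_cast
    refine Finset.sum_congr rfl fun h _ => ?_
    norm_cast
  have h2 : (∑ l ∈ Finset.univ.filter (fun l => i < l),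
      if (d : ℤ) ∣ ((sorted x i - sorted x l : ℕ) : ℤ) then (1 : ℤ) else 0) =
      ∑ l ∈ Finset.univ.filter (fun l => i < l),
        if (d : ℤ) ∣ (((sortPerm x).toEmbedding.trans x) i : ℤ) -
          (((sortPerm x).toEmbedding.trans x) l : ℤ) then 1 else 0 := by
    refine Finset.sum_congr rfl fun l hl => ?_
    rw [Nat.cast_sub (sorted_strictAnti x (Finset.mem_filter.1 hl).2).le]
    rfl
  rw [h1, h2] at h
  have h3 : (((sortPerm x).toEmbedding.trans x) i : ℤ) / d = ((sorted x i / d : ℕ) : ℤ) := by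
    rw [Int.natCast_div]
    rfl
  rw [h3]
  linarith

theorem hookCount_eq_weight (p : ℕ) (x : Position m) (L : ℕ) :
    (hookCount p (diagram x) L : ℤ) = weight x (p ^ L) := by
  rw [← sum_hook_dvd, hookCount, Finset.card_filter]
  push_cast
  refine Finset.sum_congr rfl fun c _ => ?_
  norm_cast

theorem card_diagram (x : Position m) : ((diagram x).card : ℤ) = weight x 1 := by
  rw [← sum_hook_dvd]
  simp [YoungDiagram.card]

theorem sorted_mono {x y : Position m} (h : ∀ i, y i ≤ x i) (i : Fin m) :
    sorted y i ≤ sorted x i := by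
  by_contra! hlt
  -- The coins of ranks `0, …, i` in `y` would all have rank below `i` in `x`.
  have hcard : (Finset.Iic i).card ≤ (Finset.Iio i).card := by
    refine Finset.card_le_card_of_injOn (fun l => (sortPerm x).symm (sortPerm y l)) ?_
      ((sortPerm x).symm.injective.comp (sortPerm y).injective).injOn
    intro l hl
    have hl := Finset.mem_Iic.1 (Finset.mem_coe.1 hl)
    refine Finset.mem_coe.2 (Finset.mem_Iio.2 ?_)
    rw [← (sorted_strictAnti x).lt_iff_gt, sorted_eq x ((sortPerm x).symm _),
      Equiv.apply_symm_apply]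
    have h1 := (sorted_strictAnti y).antitone hl
    have h2 := h (sortPerm y l)
    rw [← sorted_eq] at h2
    omega
  simp at hcard

theorem diagram_mono {x y : Position m} (h : ∀ i, y i ≤ x i) : diagram y ≤ diagram x := by
  intro c hc
  obtain ⟨a, b⟩ := c
  change (a, b) ∈ (diagram x).cells
  obtain ⟨i, rfl, hb⟩ := mem_diagram.1 (show (a, b) ∈ (diagram y).cells from hc)
  have := sorted_mono h i
  exact mem_diagram.2 ⟨i, rfl, by omega⟩

end Hooks

/-! ### Digits of the hook number. -/

section Digits

theorem digits_natCast (p n L : ℕ) : digits p (n : ℤ) L = ((n / p ^ L : ℕ) : ZMod p) := by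
  rw [digits, ← Nat.cast_pow, ← Int.natCast_div, Int.cast_natCast]

theorem sum_mul_pow_div_mod {p : ℕ} (f : ℕ → ℕ) (hf : ∀ L, f L < p) (K N : ℕ) :
    (∑ L ∈ Finset.range K, f L * p ^ L) / p ^ N % p = if N < K then f N else 0 := by
  have hp : 0 < p := (Nat.zero_le _).trans_lt (hf 0)
  induction K generalizing f N with
  | zero => simp
  | succ K ih =>
    have h1 : ∑ L ∈ Finset.range (K + 1), f L * p ^ L =
        f 0 + p * ∑ L ∈ Finset.range K, f (L + 1) * p ^ L := by
      rw [Finset.sum_range_succ', Finset.mul_sum, add_comm]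
      simp only [pow_zero, mul_one]
      congr 1
      exact Finset.sum_congr rfl fun L _ => by ring
    rw [h1]
    rcases N with _ | N
    · simp [Nat.mod_eq_of_lt (hf 0)]
    · rw [pow_succ', ← Nat.div_div_eq_div_mul, Nat.add_mul_div_left _ _ hp,
        Nat.div_eq_of_lt (hf 0), zero_add, ih (fun L => f (L + 1)) (fun L => hf _)]
      simp

theorem digits_hookNumber {p : ℕ} (hp : 1 < p) (μ : YoungDiagram) (L : ℕ) :
    digits p (hookNumber p μ : ℤ) L = (hookCount p μ L : ZMod p) := by
  obtain ⟨K, hK⟩ := (finite_support_hookNumber hp μ).bddAbove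
  have hsum : hookNumber p μ = ∑ l ∈ Finset.range (K + 1), (hookCount p μ l % p) * p ^ l := by
    refine finsum_eq_sum_of_support_subset _ fun l hl => ?_
    have := hK hl
    simpa using Nat.lt_succ_of_le this
  rw [digits_natCast, hsum, ← ZMod.natCast_mod, sum_mul_pow_div_mod _
    (fun l => Nat.mod_lt _ (by omega))]
  split_ifs with h
  · rw [ZMod.natCast_mod]
  · have h1 : (hookCount p μ L % p) * p ^ L = 0 := by
      by_contra hne
      exact h (Nat.lt_succ_of_le (hK hne))
    rcases mul_eq_zero.1 h1 with h2 | h2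
    · rw [← ZMod.natCast_mod (hookCount p μ L) p, h2]
    · exact absurd h2 (pow_pos (by omega) L).ne'

theorem digits_hookNumber_diagram {p m : ℕ} (hp : 1 < p) (x : Position m) (L : ℕ) :
    digits p (hookNumber p (diagram x) : ℤ) L = (weight x (p ^ L) : ZMod p) := by
  rw [digits_hookNumber hp, ← hookCount_eq_weight, Int.cast_natCast]

end Digits

/-! ### The Sprague-Grundy function and descendants. -/

section Game

variable {m : ℕ}

theorem intCast_zmod_eq_iff_dvd_sub {p : ℕ} (a b : ℤ) :
    (a : ZMod p) = (b : ZMod p) ↔ (p : ℤ) ∣ a - b := by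
  rw [ZMod.intCast_eq_intCast_iff, Int.modEq_comm, Int.modEq_iff_dvd]

theorem dvd_weight_sub_hookNumber_div {p : ℕ} (hp : 1 < p) (x : Position m) (L : ℕ) :
    (p : ℤ) ∣ weight x (p ^ L) - (hookNumber p (diagram x) / p ^ L : ℕ) := by
  rw [← intCast_zmod_eq_iff_dvd_sub, ← digits_hookNumber_diagram hp, digits_natCast,
    Int.cast_natCast]

theorem hookNumber_ne_of_welterMove {p k : ℕ} (hp : 1 < p) {x y : Position m}
    (h : WelterMove p m k x y) :
    hookNumber p (diagram y) ≠ hookNumber p (diagram x) := by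
  intro heq
  have hsum : (0 : ℤ) < ∑ i, ((x i : ℤ) - y i) := by
    have := h.sum_lt
    rw [Finset.sum_sub_distrib]
    have : ((∑ i, y i : ℕ) : ℤ) < (∑ i, x i : ℕ) := by exact_mod_cast this
    push_cast at this
    linarith
  obtain ⟨-, hle, hord⟩ := h
  have hfin : FiniteMultiplicity (p : ℤ) (∑ i, ((x i : ℤ) - y i)) :=
    Int.finiteMultiplicity_iff.2 ⟨by simp; omega, hsum.ne'⟩
  set N := multiplicity (p : ℤ) (∑ i, ((x i : ℤ) - y i))
  have hN : emultiplicity (p : ℤ) (∑ i, ((x i : ℤ) - y i)) = N :=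
    hfin.emultiplicity_eq_multiplicity
  have hpN : (0 : ℤ) < (p ^ N : ℕ) := by exact_mod_cast pow_pos (by omega) N
  have hmod : LeMod (p ^ N) y x := fun i => ⟨hle i, by
    push_cast
    refine pow_dvd_of_le_emultiplicity ?_
    rw [← hN, hord]
    exact iInf_le _ i⟩
  have hdig : (weight x (p ^ N) : ZMod p) = (weight y (p ^ N) : ZMod p) := by
    rw [← digits_hookNumber_diagram hp, ← digits_hookNumber_diagram hp, heq]
  have hdvd : (p : ℤ) ∣ weight x (p ^ N) - weight y (p ^ N) :=
    (intCast_zmod_eq_iff_dvd_sub _ _).1 hdig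
  have h1 := hmod.mul_weight_sub
  have h2 : (p : ℤ) ^ (N + 1) ∣ ∑ i, ((x i : ℤ) - y i) := by
    rw [← h1, pow_succ]
    push_cast
    exact mul_dvd_mul_left _ hdvd
  have h3 := le_emultiplicity_of_pow_dvd h2
  rw [hN] at h3
  exact absurd (Nat.cast_le.1 h3) (by omega)

theorem LeMod.welterMove {p N : ℕ} (hp : 1 < p) {x y : Position m} (h : LeMod (p ^ N) y x)
    (hw : ¬ (p : ℤ) ∣ weight x (p ^ N) - weight y (p ^ N)) : WelterMove p m (m + 1) x y := by
  have hpN : ((p : ℤ) ^ N) ≠ 0 := pow_ne_zero _ (by omega)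
  have h1 := h.mul_weight_sub
  push_cast at h1
  have hlt : ¬ (p : ℤ) ^ (N + 1) ∣ ∑ i, ((x i : ℤ) - y i) := by
    rw [← h1, pow_succ]
    exact fun hdvd => hw (Int.dvd_of_mul_dvd_mul_left hpN hdvd)
  have hsum : emultiplicity (p : ℤ) (∑ i, ((x i : ℤ) - y i)) = N :=
    emultiplicity_eq_coe.2 ⟨⟨_, h1.symm⟩, hlt⟩
  refine ⟨⟨hammingDist_pos.2 fun heq => hw ?_, ?_⟩, fun i => (h i).1, ?_⟩
  · rw [DFunLike.coe_injective heq]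
    simp
  · exact Nat.lt_succ_of_le (hammingDist_le_card_fintype.trans_eq (Fintype.card_fin m))
  · rw [hsum]
    refine le_antisymm (le_iInf fun i => le_emultiplicity_of_pow_dvd ?_) ?_
    · have := (h i).2
      push_cast at this
      exact this
    · by_contra! hgt
      refine hlt (Finset.dvd_sum fun i _ => pow_dvd_of_le_emultiplicity ?_)
      have := hgt.trans_le (iInf_le _ i)
      push_cast
      exact Order.add_one_le_of_lt this

theorem exists_welterMove_hookNumber_eq {p n : ℕ} (hp : 1 < p) {x : Position m}
    (hn : n < hookNumber p (diagram x)) :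
    ∃ y, WelterMove p m (m + 1) x y ∧ hookNumber p (diagram y) = n := by
  have hex : ∃ L, digits p (n : ℤ) L ≠ digits p (hookNumber p (diagram x) : ℤ) L := by
    by_contra! hall
    exact hn.ne (by exact_mod_cast digits_injective hp (funext hall))
  classical
  obtain ⟨N, hN, hmin⟩ : ∃ N, digits p (n : ℤ) N ≠ digits p (hookNumber p (diagram x) : ℤ) N ∧
      ∀ L < N, digits p (n : ℤ) L = digits p (hookNumber p (diagram x) : ℤ) L :=
    ⟨Nat.find hex, Nat.find_spec hex, fun n hn => not_not.1 (Nat.find_min hex hn)⟩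
  obtain ⟨y, hy, hyw⟩ := exists_weight_eq_div hp x _
    (dvd_weight_sub_hookNumber_div hp x) N (n / p ^ N) (Nat.div_le_div_right hn.le)
  have hhigh : ∀ L, N ≤ L → digits p (hookNumber p (diagram y) : ℤ) L = digits p (n : ℤ) L := by
    intro L hL
    obtain ⟨l, rfl⟩ := Nat.exists_eq_add_of_le hL
    rw [digits_hookNumber_diagram hp, hyw, digits_natCast, Nat.div_div_eq_div_mul, ← pow_add,
      Int.cast_natCast]
  refine ⟨y, hy.welterMove hp fun hdvd => hN ?_, ?_⟩
  · rw [← hhigh N le_rfl, digits_hookNumber_diagram hp, digits_hookNumber_diagram hp]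
    exact ((intCast_zmod_eq_iff_dvd_sub _ _).2 hdvd).symm
  · have : digits p (hookNumber p (diagram y) : ℤ) = digits p (n : ℤ) := by
      funext L
      rcases le_or_gt N L with hL | hL
      · exact hhigh L hL
      -- Displacements divisible by `p ^ N` change the weight at `p ^ L` by a multiple of `p ^ (N -
      -- L)`.
      · rw [hmin L hL, digits_hookNumber_diagram hp, digits_hookNumber_diagram hp, eq_comm,
          intCast_zmod_eq_iff_dvd_sub,
          LeMod.weight_sub (n := p ^ (N - L)) (pow_pos (by omega) L)
            (by rwa [← pow_add, Nat.add_sub_cancel' hL.le])]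
        exact dvd_mul_of_dvd_left (Int.natCast_dvd_natCast.2 (dvd_pow_self p (by omega))) _
    exact_mod_cast digits_injective hp this

theorem sg_welter {p : ℕ} (hp : 1 < p) (x : Position m) :
    (welter p m (m + 1)).sg x = hookNumber p (diagram x) := by
  induction x using (welter p m (m + 1)).wellFounded.induction with
  | _ x ih =>
  rw [ImpartialGame.sg_eq]
  refine IsLeast.csInf_eq ⟨fun y hy => ?_, fun n hn => ?_⟩
  · rw [ih y hy]
    exact hookNumber_ne_of_welterMove hp hy
  · by_contra! hlt
    obtain ⟨y, hy, hyn⟩ := exists_welterMove_hookNumber_eq hp hlt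
    exact hn y hy ((ih y hy).trans hyn)

/-- Moving a single coin is a legal move. -/
theorem exists_welterMove_of_le {p : ℕ} {x y : Position m} (hle : ∀ i, y i ≤ x i) (hne : x ≠ y) :
    ∃ z : Position m, (∀ k, 2 ≤ k → WelterMove p m k x z) ∧ (∀ i, y i ≤ z i) ∧
      hammingDist (⇑z) (⇑y) < hammingDist (⇑x) (⇑y) := by
  have hne' : (Finset.univ.filter fun i => x i ≠ y i).Nonempty := by
    obtain ⟨i, hi⟩ := Function.ne_iff.1 fun h : (⇑x : Fin m → ℕ) = ⇑y =>
      hne (DFunLike.coe_injective h)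
    exact ⟨i, by simpa using hi⟩
  -- The lowest coin still to be moved has a vacant target: coins already in place avoid it, and the
  -- others lie at or above `x i`.
  obtain ⟨i, hi, hmin⟩ := Finset.exists_min_image _ (fun i => x i) hne'
  have hi : x i ≠ y i := (Finset.mem_filter.1 hi).2
  have hmin : ∀ j, x j ≠ y j → x i ≤ x j := fun j hj => hmin j (by simpa using hj)
  have hlt : y i < x i := lt_of_le_of_ne (hle i) hi.symm
  have hvac : ∀ j, j ≠ i → x j ≠ y i := by
    intro j hj h
    by_cases hxy : x j = y j
    · exact hj (y.injective (hxy.symm.trans h))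
    · have := hmin j hxy
      omega
  let z : Position m :=
    { toFun := Function.update (⇑x) i (y i)
      inj' := by
        intro a b hab
        by_cases ha : a = i <;> by_cases hb : b = i
        · exact ha.trans hb.symm
        · subst ha
          rw [Function.update_self, Function.update_of_ne hb] at hab
          exact absurd hab.symm (hvac b hb)
        · subst hb
          rw [Function.update_self, Function.update_of_ne ha] at hab
          exact absurd hab (hvac a ha)
        · rw [Function.update_of_ne ha, Function.update_of_ne hb] at hab
          exact x.injective hab }
  have hzi : z i = y i := Function.update_self ..
  have hzj : ∀ j, j ≠ i → z j = x j := fun j hj => Function.update_of_ne hj ..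
  refine ⟨z, fun k hk => ⟨?_, fun j => ?_, ?_⟩, fun j => ?_, ?_⟩
  · have : hammingDist (⇑x) (⇑z) = 1 := by
      rw [hammingDist, Finset.card_eq_one]
      refine ⟨i, ?_⟩
      ext j
      by_cases hj : j = i
      · subst hj; simp [hzi, hi]
      · simp [hzj j hj, hj]
    omega
  · by_cases hj : j = i
    · subst hj; rw [hzi]; exact hlt.le
    · rw [hzj j hj]
  · have hz0 : ∀ j, j ≠ i → (x j : ℤ) - z j = 0 := fun j hj => by rw [hzj j hj, sub_self]
    rw [Finset.sum_eq_single i (fun j _ hj => hz0 j hj) (by simp)]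
    refine le_antisymm (le_iInf fun j => ?_) (iInf_le _ i)
    by_cases hj : j = i
    · rw [hj]
    · rw [hz0 j hj, emultiplicity_zero]
      exact le_top
  · by_cases hj : j = i
    · subst hj; rw [hzi]
    · rw [hzj j hj]; exact hle j
  · refine Finset.card_lt_card ⟨fun j hj => ?_, fun hsub => ?_⟩
    · have hj := (Finset.mem_filter.1 hj).2
      refine Finset.mem_filter.2 ⟨Finset.mem_univ j, ?_⟩
      by_cases hji : j = i
      · exact absurd (hji ▸ hzi) hj
      · rwa [hzj j hji] at hj
    · exact (Finset.mem_filter.1 (hsub (Finset.mem_filter.2 ⟨Finset.mem_univ i, hi⟩))).2 hzi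

theorem isDescendant_of_le {p k : ℕ} (hk : 2 ≤ k) {x y : Position m} (hle : ∀ i, y i ≤ x i) :
    (welter p m k).IsDescendant x y := by
  induction hn : hammingDist (⇑x) (⇑y) using Nat.strong_induction_on generalizing x with
  | _ n ih =>
  by_cases hxy : x = y
  · exact hxy ▸ Relation.ReflTransGen.refl
  · obtain ⟨z, hz, hzle, hlt⟩ := exists_welterMove_of_le (p := p) hle hxy
    exact Relation.ReflTransGen.head (hz k hk) (ih _ (hn ▸ hlt) hzle rfl)

theorem IsSaturation.isDescendant_of_le {p k : ℕ} (hp : 1 < p) (hsat : IsSaturation p m k)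
    {x y : Position m} (hle : ∀ i, y i ≤ x i) : (welter p m k).IsDescendant x y := by
  rcases (by have := hsat.1; omega : k = 1 ∨ 2 ≤ k) with rfl | hk
  -- For `k = 1` there are no moves and all values are 0; a legal move of the full game would change
  -- the value, so `x = y`.
  · by_cases hxy : x = y
    · exact hxy ▸ Relation.ReflTransGen.refl
    · exfalso
      obtain ⟨z, hz, -, -⟩ := exists_welterMove_of_le (p := p) hle hxy
      have hm : 2 ≤ m + 1 := by
        rcases m with _ | m
        · exact absurd (DFunLike.ext x y fun i => i.elim0) hxy
        · omega
      have hzero : ∀ w, (welter p m 1).sg w = 0 := fun w => by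
        rw [ImpartialGame.sg_eq, Nat.sInf_eq_zero]
        refine Or.inl fun v hv => ?_
        have := hv.1
        omega
      have h1 := hookNumber_ne_of_welterMove hp (hz _ hm)
      rw [← sg_welter hp, ← sg_welter hp, ← hsat.2, hzero, hzero] at h1
      exact h1 rfl
  · exact WelterGame.isDescendant_of_le hk hle

end Game

end WelterGame

theorem theorem1p1 (p : ℕ) (hp : 1 < p) (m k : ℕ) (hk : WelterGame.IsSaturation p m k)
    (x : WelterGame.Position m) :
    (WelterGame.welter p m k).sg x = WelterGame.hookNumber p (WelterGame.diagram x) ∧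
    WelterGame.digits p ((WelterGame.welter p m k).sg x : ℤ) =
      (∑ i, WelterGame.digits p (x i : ℤ)) -
        ∑ i, ∑ j ∈ Finset.univ.filter (fun j => i < j),
          WelterGame.carryfreeN p ((x i : ℤ) - (x j : ℤ)) ∧
    WelterGame.digits p ((WelterGame.welter p m k).sg x : ℤ) =
      ∑ c ∈ (WelterGame.diagram x).cells,
        WelterGame.carryfreeN p ((WelterGame.hook (WelterGame.diagram x) c).card : ℤ) ∧
    ∃ y : WelterGame.Position m,
      (WelterGame.welter p m k).IsDescendant x y ∧
      WelterGame.diagram y ≤ WelterGame.diagram x ∧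
      (WelterGame.diagram y).card = (WelterGame.welter p m k).sg y ∧
      (WelterGame.welter p m k).sg y = (WelterGame.welter p m k).sg x := by
  open WelterGame in
  have hsg : ∀ y, (welter p m k).sg y = hookNumber p (diagram y) := fun y => by
    rw [hk.2, sg_welter hp]
  have hp0 : 0 < p := by omega
  simp only [hsg]
  refine ⟨trivial, ?_, ?_, ?_⟩
  · funext L
    rw [digits_hookNumber_diagram hp, weight]
    simp only [Pi.sub_apply, Finset.sum_apply, carryfreeN_apply hp0, digits]
    push_cast
    rfl
  · funext L
    rw [digits_hookNumber_diagram hp, ← sum_hook_dvd]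
    simp only [Finset.sum_apply, carryfreeN_apply hp0]
    push_cast
    rfl
  -- At `N = 0` with the full value of `x` prescribed, the weight at modulus 1, which counts the
  -- cells, equals that value.
  · obtain ⟨y, hy, hyw⟩ := exists_weight_eq_div hp x _ (dvd_weight_sub_hookNumber_div hp x) 0 (hookNumber p (diagram x)) (by simp)
    have hyx : hookNumber p (diagram y) = hookNumber p (diagram x) := by
      have : digits p (hookNumber p (diagram y) : ℤ) = digits p (hookNumber p (diagram x) : ℤ) := by
        funext L
        have := hyw L
        rw [zero_add] at this
        rw [digits_hookNumber_diagram hp y, this, digits_natCast, Int.cast_natCast]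
      exact_mod_cast digits_injective hp this
    refine ⟨y, hk.isDescendant_of_le hp fun i => (hy i).1, diagram_mono fun i => (hy i).1, ?_, hyx⟩
    have h1 := hyw 0
    have h2 := card_diagram y
    rw [add_zero, pow_zero] at h1
    rw [h1, Nat.div_one] at h2
    rw [hyx]
    exact_mod_cast h2
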